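/- For a topological space $X$ whose total rational singular homology is finite-dimensional, let $\chi(X)=\sum_k(-1)^k\dim H_k(X;\mathbf{Q})$. For a finite group $G$ let $Com(G,m)$ be the set of $m$-tuples of mutually commuting elements of $G$, and for an action of $G$ on $X$ put $$\chi_m(X,G)=\frac{1}{|G|}\sum_{(g_1,\dots,g_m)\in Com(G,m)}\chi\big(X^{(g_1,\dots,g_m)}\big),$$ where $X^{(g_1,\dots,g_m)}$ is the simultaneous fixed point set of $g_1,\dots,g_m$. For permutations $\pi_1,\dots,\pi_m\in S_n$ let $\#(\pi_1,\dots,\pi_m)$ be the number of connected components of the graph on $\{1,\dots,n\}$ in which every vertex $a$ is joined to $\pi_1(a),\dots,\pi_m(a)$. Theorem. Let $M$ be a manifold (Hausdorff, second countable, finite-dimensional, possibly with boundary or corners) whose total rational homology is finite-dimensional, let $\chi=\chi(M)$, and let $m\ge 1$. Let $S_n$ act on $M^n$ by permuting the factors. Then all the Euler characteristics that occur in $\chi_m(M^n,S_n)$ are defined, and in the ring of formal power series $\mathbf{Q}[[u]]$ $$\sum_{n=0}^\infty \chi_m(M^n,S_n)\,u^n=\sum_{n=0}^\infty\frac{u^n}{n!}\sum_{(\pi_1,\dots,\pi_m)\in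 Com(S_n,m)}\chi^{\#(\pi_1,\dots,\pi_m)}$$ $$=\left(\sum_{n=0}^\infty |Com(S_n,m)|\,\frac{u^n}{n!}\right)^{\chi}$$ $$=\prod_{i_1,\dots,i_{m-1}=1}^\infty\left(1-u^{i_1\cdots i_{m-1}}\right)^{-\chi\, i_1^{m-2}i_2^{m-3}\cdots i_{m-2}},$$ where the infinite product converges coefficientwise. For $m=1$ the product has the single factor $(1-u)^{-\chi}$. -/

import Mathlib

open scoped Manifold PowerSeries

universe u

noncomputable section

/-! ### The Euler characteristic of a topological space -/

/-- The singular chain complex of `X` with rational coefficients. -/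
def rationalSingularChains (X : Type u) [TopologicalSpace X] :
    ChainComplex (ModuleCat.{u} ℚ) ℕ :=
  ((AlgebraicTopology.singularChainComplexFunctor (ModuleCat.{u} ℚ)).obj
    (ModuleCat.of ℚ (ULift.{u} ℚ))).obj (TopCat.of X)

/-- The total rational singular homology of `X` is finite-dimensional,
i.e. the Euler characteristic of `X` is defined. -/
def HasFiniteRationalHomology (X : Type u) [TopologicalSpace X] : Prop :=
  (∀ k : ℕ, FiniteDimensional ℚ ((rationalSingularChains X).homology k)) ∧
    ∃ N : ℕ, ∀ k : ℕ, N ≤ k → Subsingleton ((rationalSingularChains X).homology k)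

/-- The Euler characteristic `∑ₖ (-1)ᵏ dim H_k(X; ℚ)`
(a meaningful value only when `HasFiniteRationalHomology X`). -/
def eulerCharacteristic (X : Type u) [TopologicalSpace X] : ℤ :=
  (rationalSingularChains X).homologyEulerChar

/-! ### Commuting tuples and orbifold Euler characteristics -/

open Classical in
/-- `Com(G, m)`: the `m`-tuples of mutually commuting elements of the finite group `G`. -/
def commutingTuples (G : Type*) [Group G] [Fintype G] (m : ℕ) : Finset (Fin m → G) :=
  Finset.univ.filter fun g => ∀ i j, Commute (g i) (g j)

/-- The simultaneous fixed point set `X^{(g₁, …, g_m)}`. -/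
def simultaneousFixedPoints {G : Type*} [Group G] (X : Type u) [MulAction G X] {m : ℕ}
    (g : Fin m → G) : Set X :=
  {x | ∀ j, g j • x = x}

/-- The `m`-th orbifold Euler characteristic `χ_m(X, G)`. -/
def orbifoldEulerCharacteristic (m : ℕ) (X : Type u) [TopologicalSpace X]
    (G : Type*) [Group G] [Fintype G] [MulAction G X] : ℚ :=
  (1 / (Fintype.card G : ℚ)) *
    ∑ g ∈ commutingTuples G m, (eulerCharacteristic (simultaneousFixedPoints X g) : ℚ)

/-- The permutation action of `S_n` on the `n`-fold product `M^n`: `(π • x) i = x (π⁻¹ i)`. -/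
instance permProductAction (M : Type u) (n : ℕ) :
    MulAction (Equiv.Perm (Fin n)) (Fin n → M) :=
  arrowAction

/-- The graph on the vertices `1, …, n` which joins each vertex `a` to `π₁ a, …, π_m a`. -/
def tupleGraph {n m : ℕ} (π : Fin m → Equiv.Perm (Fin n)) : SimpleGraph (Fin n) :=
  SimpleGraph.fromRel fun a b => ∃ j, π j a = b

/-- `#(π₁, …, π_m)`: the number of connected components of this graph. -/
def numComponents {n m : ℕ} (π : Fin m → Equiv.Perm (Fin n)) : ℕ :=
  Nat.card (tupleGraph π).ConnectedComponent

/-! ### Formal power series -/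

/-- The power `f ^ k` of a formal power series with an integer exponent
(used for series with nonzero constant coefficient, where `f⁻¹` is the inverse of `f`). -/
def seriesZPow (f : ℚ⟦X⟧) : ℤ → ℚ⟦X⟧
  | Int.ofNat k => f ^ k
  | Int.negSucc k => f⁻¹ ^ (k + 1)

/-- The infinite product `∏ f i` converges to `g` as a formal power series: every coefficient of
the finite subproducts is eventually constant, equal to the corresponding coefficient of `g`. -/
def HasFormalProd {ι : Type*} (f : ι → ℚ⟦X⟧) (g : ℚ⟦X⟧) : Prop :=
  ∀ d : ℕ, ∀ᶠ s : Finset ι in Filter.atTop,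
    PowerSeries.coeff d (∏ i ∈ s, f i) = PowerSeries.coeff d g

/-- The generating function `∑ₙ χ_m(M^n, S_n) uⁿ`. -/
def orbifoldGeneratingFunction (M : Type u) [TopologicalSpace M] (m : ℕ) : ℚ⟦X⟧ :=
  PowerSeries.mk fun n => orbifoldEulerCharacteristic m (Fin n → M) (Equiv.Perm (Fin n))

end

/-!
The fixed points of commuting permutations `π₁, …, π_m` on `M ^ n` are the functions from the set of
components to `M`, so the Künneth formula gives them the Euler characteristic `χ ^ #`. For the
Künneth formula, the chains `A` on a space split off a constant simplicial vector space `π₀ A`, and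
the rest is the base of an extension of a contractible path object by a loop object; tensoring with
`B` preserves all of this, so the homology of `A ⊗ B` is computed by dimension shifting.

Commuting `m`-tuples in `S_n` are the actions of `G = ℤ ^ m` on `n` points, and their components are
the orbits. A transitive action on `k` points with a chosen point is a subgroup of index `k`
together with a labelling of the other cosets; splitting off the orbit of one point therefore shows
that `∑ₙ (∑_φ x ^ #orbits(φ)) uⁿ / n!` has logarithmic derivative `x ∑ₖ s_G(k + 1) uᵏ`, where
`s_G(k)` is the number of subgroups of index `k`. As this is linear in `x`, the series for `x = χ`
is the `χ`-th power of the one for `x = 1`.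

A subgroup `L` of `G × ℤ` is determined by `K = L ∩ G`, the index `e` of its projection to `ℤ`, and
a coset of `K`, and has index `e [G : K]`. Hence `s_{G × ℤ}(n) = ∑_{d ∣ n} d s_G(d)`, so that by
induction on `m` the logarithmic derivative agrees with that of the infinite product.
-/

noncomputable section

open CategoryTheory Simplicial Opposite AlgebraicTopology TensorProduct

/-! ### The décalage of a simplicial object -/

/-- The functor `[n] ↦ [0] ⋆ [n]` on the simplex category; the cone point is the vertex `0`. -/
def simplexCone : SimplexCategory ⥤ SimplexCategory where
  obj n := ⦋n.len + 1⦌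
  map f := SimplexCategory.mkHom
    ⟨Fin.cases 0 fun i => (f.toOrderHom i).succ, fun a b hab => by
      cases a using Fin.cases with
      | zero => exact Fin.zero_le _
      | succ a =>
        cases b using Fin.cases with
        | zero => exact absurd hab (Fin.succ_pos a).not_ge
        | succ b =>
          exact Fin.succ_le_succ_iff.2 (f.toOrderHom.monotone (Fin.succ_le_succ_iff.1 hab))⟩
  map_id n := by
    ext i
    cases i using Fin.cases <;> rfl
  map_comp f g := by
    ext i
    cases i using Fin.cases <;> rfl

namespace simplexCone

/-- The inclusion `[n] ⟶ [0] ⋆ [n]`. -/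
def incl : 𝟭 SimplexCategory ⟶ simplexCone where
  app _ := SimplexCategory.mkHom ⟨Fin.succ, Fin.strictMono_succ.monotone⟩

/-- The cone point of `[0] ⋆ [n]`. -/
def vertex (n : SimplexCategory) : ⦋0⦌ ⟶ simplexCone.obj n :=
  SimplexCategory.const _ _ (0 : Fin (n.len + 2))

lemma vertex_comp_map {m n : SimplexCategory} (f : m ⟶ n) :
    vertex m ≫ simplexCone.map f = vertex n := rfl

/-- The map `[0] ⋆ [n + 1] ⟶ [0] ⋆ [n]` which sends the first `j + 1` vertices of `[n + 1]`
to the cone point, and is the degeneracy on the remaining ones. These maps assemble to the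
contraction of the cone. -/
def collapse {n : ℕ} (j : Fin (n + 1)) : ⦋n + 2⦌ ⟶ ⦋n + 1⦌ :=
  SimplexCategory.mkHom
    ⟨fun t : Fin (n + 3) => ⟨if (t : ℕ) ≤ j + 1 then 0 else t - 1, by grind⟩,
      fun a b (hab : (a : ℕ) ≤ b) => by
        rw [Fin.mk_le_mk]
        grind⟩

lemma collapse_apply {n : ℕ} (j : Fin (n + 1)) (t : Fin (n + 3)) :
    ((collapse j).toOrderHom t : ℕ) = if (t : ℕ) ≤ j + 1 then 0 else (t : ℕ) - 1 := rfl

/-- The image of a coface map under the cone functor. -/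
def δ {n : ℕ} (i : Fin (n + 2)) : ⦋n + 1⦌ ⟶ ⦋n + 2⦌ := simplexCone.map (SimplexCategory.δ i)

/-- The image of a codegeneracy map under the cone functor. -/
def σ {n : ℕ} (i : Fin (n + 1)) : ⦋n + 2⦌ ⟶ ⦋n + 1⦌ := simplexCone.map (SimplexCategory.σ i)

lemma δ_apply {n : ℕ} (i : Fin (n + 2)) (t : Fin (n + 2)) :
    ((δ i).toOrderHom t : ℕ) = if (t : ℕ) ≤ i then (t : ℕ) else t + 1 := by
  cases t using Fin.cases with
  | zero => exact (if_pos (Nat.zero_le _)).symm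
  | succ t =>
    change ((Fin.succAbove i t).succ : ℕ) = _
    grind [Fin.succAbove]

lemma σ_apply {n : ℕ} (i : Fin (n + 1)) (t : Fin (n + 3)) :
    ((σ i).toOrderHom t : ℕ) = if (t : ℕ) ≤ i + 1 then (t : ℕ) else t - 1 := by
  cases t using Fin.cases with
  | zero => exact (if_pos (Nat.zero_le _)).symm
  | succ t =>
    change ((Fin.predAbove i t).succ : ℕ) = _
    grind [Fin.predAbove, Fin.coe_castPred]

lemma δ_zero_collapse (n : ℕ) :
    δ 0 ≫ collapse 0 = 𝟙 ⦋n + 1⦌ := by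
  ext t
  simp only [SimplexCategory.comp_toOrderHom, OrderHom.comp_coe, Function.comp_apply,
    collapse_apply, δ_apply, Fin.coe_ofNat_eq_mod, Nat.zero_mod, nonpos_iff_eq_zero,
    Fin.val_eq_zero_iff, zero_add, SimplexCategory.id_toOrderHom, OrderHom.id_coe, id_eq]
  grind

lemma δ_last_collapse (n : ℕ) :
    δ (Fin.last (n + 1)) ≫ collapse (Fin.last n) =
      SimplexCategory.const ⦋n + 1⦌ ⦋0⦌ 0 ≫ SimplexCategory.const ⦋0⦌ ⦋n + 1⦌ 0 := by
  ext t
  simp only [SimplexCategory.comp_toOrderHom, OrderHom.comp_coe, Function.comp_apply,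
    collapse_apply, δ_apply, Fin.val_last, SimplexCategory.const_apply, Fin.coe_ofNat_eq_mod,
    Nat.zero_mod, ite_eq_left_iff, not_le]
  grind

lemma δ_castSucc_collapse_succ {n : ℕ} (i : Fin (n + 2)) (j : Fin (n + 1))
    (hij : i ≤ j.castSucc) :
    δ i.castSucc ≫ collapse j.succ = collapse j ≫ δ i := by
  ext t
  simp only [SimplexCategory.comp_toOrderHom, OrderHom.comp_coe, Function.comp_apply,
    collapse_apply, δ_apply]
  grind

lemma δ_collapse_succ {n : ℕ} (j : Fin (n + 1)) :
    δ j.castSucc.succ ≫ collapse j.succ = δ j.castSucc.succ ≫ collapse j.castSucc := by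
  ext t
  simp only [SimplexCategory.comp_toOrderHom, OrderHom.comp_coe, Function.comp_apply,
    collapse_apply, δ_apply]
  grind

lemma δ_succ_collapse_castSucc {n : ℕ} (i : Fin (n + 2)) (j : Fin (n + 1))
    (hij : j.castSucc < i) :
    δ i.succ ≫ collapse j.castSucc = collapse j ≫ δ i := by
  ext t
  simp only [SimplexCategory.comp_toOrderHom, OrderHom.comp_coe, Function.comp_apply,
    collapse_apply, δ_apply]
  grind

lemma σ_castSucc_collapse {n : ℕ} (i j : Fin (n + 1)) (hij : i ≤ j) :
    σ i.castSucc ≫ collapse j = collapse j.succ ≫ σ i := by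
  ext t
  simp only [SimplexCategory.comp_toOrderHom, OrderHom.comp_coe, Function.comp_apply,
    collapse_apply, σ_apply]
  grind

lemma σ_succ_collapse {n : ℕ} (i j : Fin (n + 1)) (hij : j ≤ i) :
    σ i.succ ≫ collapse j = collapse j.castSucc ≫ σ i := by
  ext t
  simp only [SimplexCategory.comp_toOrderHom, OrderHom.comp_coe, Function.comp_apply,
    collapse_apply, σ_apply]
  grind

end simplexCone

section Decalage

variable {C : Type*} [Category* C] (A : SimplicialObject C)

lemma map_op_comp_eq {k m n : SimplexCategory} {f : k ⟶ m} {g : m ⟶ n} {h : k ⟶ n}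
    (w : f ≫ g = h) : A.map g.op ≫ A.map f.op = A.map h.op := by
  rw [← A.map_comp, ← op_comp, w]

lemma map_op_comp_eq_map_op_comp {k m m' n : SimplexCategory} {f : k ⟶ m} {g : m ⟶ n}
    {f' : k ⟶ m'} {g' : m' ⟶ n} (w : f ≫ g = f' ≫ g') :
    A.map g.op ≫ A.map f.op = A.map g'.op ≫ A.map f'.op :=
  (map_op_comp_eq A w).trans (map_op_comp_eq A rfl).symm

/-- The décalage `n ↦ A_{n + 1}` of a simplicial object, obtained by forgetting the vertex `0`. -/
def decalage : SimplicialObject C := simplexCone.op ⋙ A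

namespace decalage

/-- The projection of the décalage to the faces opposite to the cone point. -/
def proj : decalage A ⟶ A := Functor.whiskerRight (NatTrans.op simplexCone.incl) A

/-- The augmentation of the décalage, which evaluates at the cone point. -/
def augmentation : decalage A ⟶ (SimplicialObject.const C).obj (A _⦋0⦌) where
  app n := A.map (simplexCone.vertex n.unop).op
  naturality _ _ f :=
    (map_op_comp_eq A (simplexCone.vertex_comp_map f.unop)).trans (Category.comp_id _).symm

/-- The section of the augmentation given by the degenerate simplices. -/
def degeneracy : (SimplicialObject.const C).obj (A _⦋0⦌) ⟶ decalage A where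
  app n := A.map (SimplexCategory.const (simplexCone.obj n.unop) ⦋0⦌ 0).op
  naturality m _ f := (Category.id_comp _).trans
    (map_op_comp_eq A (f := simplexCone.map f.unop)
      (g := SimplexCategory.const (simplexCone.obj m.unop) ⦋0⦌ 0) rfl).symm

lemma degeneracy_comp_augmentation : degeneracy A ≫ augmentation A = 𝟙 _ := by
  ext n
  exact (map_op_comp_eq A (SimplexCategory.Hom.ext_zero_left
    (simplexCone.vertex n.unop ≫ SimplexCategory.const _ ⦋0⦌ 0) (𝟙 ⦋0⦌))).trans (A.map_id _)

/-- The contraction of the décalage onto the vertices. -/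
def contraction :
    SimplicialObject.Homotopy (augmentation A ≫ degeneracy A) (𝟙 (decalage A)) where
  h j := A.map (simplexCone.collapse j).op
  h_zero_comp_δ_zero n :=
    (map_op_comp_eq A (simplexCone.δ_zero_collapse n)).trans (A.map_id _)
  h_last_comp_δ_last n := map_op_comp_eq_map_op_comp A (simplexCone.δ_last_collapse n)
  h_succ_comp_δ_castSucc_of_lt i j hij :=
    map_op_comp_eq_map_op_comp A (simplexCone.δ_castSucc_collapse_succ i j hij)
  h_succ_comp_δ_castSucc_succ j := map_op_comp_eq_map_op_comp A (simplexCone.δ_collapse_succ j)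
  h_castSucc_comp_δ_succ_of_lt i j hij :=
    map_op_comp_eq_map_op_comp A (simplexCone.δ_succ_collapse_castSucc i j hij)
  h_comp_σ_castSucc_of_le i j hij :=
    map_op_comp_eq_map_op_comp A (simplexCone.σ_castSucc_collapse i j hij)
  h_comp_σ_succ_of_lt i j hij :=
    map_op_comp_eq_map_op_comp A (simplexCone.σ_succ_collapse i j hij)

end decalage

end Decalage

/-! ### The path and loop objects -/

section Loop

open Limits

variable {C : Type*} [Category* C] [Abelian C]

/-- The kernel sequence of a split epimorphism splits. -/
def kernelSplitting {X Y : C} {p : X ⟶ Y} {s : Y ⟶ X} (h : s ≫ p = 𝟙 Y) :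
    (ShortComplex.kernelSequence p).Splitting :=
  .ofExactOfSection _ (ShortComplex.kernelSequence_exact p) s h inferInstance

lemma isZero_map_kernel {D : Type*} [Category* D] [Preadditive D] (T : C ⥤ D) [T.Additive]
    {X Y : C} {p : X ⟶ Y} {s : Y ⟶ X} (h : s ≫ p = 𝟙 Y) (hT : T.map (p ≫ s) = 𝟙 (T.obj X)) :
    IsZero (T.obj (kernel p)) := by
  have hι : T.map (kernel.ι p) = 0 := by
    rw [← Category.comp_id (T.map _), ← hT, ← T.map_comp, kernel.condition_assoc, zero_comp,
      T.map_zero]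
  have : IsSplitMono (kernel.ι p) := ⟨⟨(kernelSplitting h).splitMono_f⟩⟩
  exact IsZero.of_mono_eq_zero _ hι

variable (A : SimplicialObject C)

/-- The difference of the end points of an edge. -/
abbrev edgeBoundary : A _⦋1⦌ ⟶ A _⦋0⦌ := A.δ 0 - A.δ 1

/-- The zeroth homotopy of a simplicial object of an abelian category: its vertices modulo the
differences of end points of edges. -/
abbrev pi₀ : C := cokernel (edgeBoundary A)

lemma map_const_comp_cokernel_π {n : ℕ} (i j : Fin (n + 1)) :
    A.map (SimplexCategory.const ⦋0⦌ ⦋n⦌ i).op ≫ cokernel.π (edgeBoundary A) =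
      A.map (SimplexCategory.const ⦋0⦌ ⦋n⦌ j).op ≫ cokernel.π (edgeBoundary A) := by
  wlog hij : i ≤ j
  · exact (this A j i (le_of_not_ge hij)).symm
  have hj : SimplexCategory.δ (0 : Fin 2) ≫ SimplexCategory.mkOfLe i j hij =
      SimplexCategory.const ⦋0⦌ ⦋n⦌ j := SimplexCategory.Hom.ext_zero_left _ _
  have hi : SimplexCategory.δ (1 : Fin 2) ≫ SimplexCategory.mkOfLe i j hij =
      SimplexCategory.const ⦋0⦌ ⦋n⦌ i := SimplexCategory.Hom.ext_zero_left _ _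
  have hδ : A.δ 0 ≫ cokernel.π (edgeBoundary A) = A.δ 1 ≫ cokernel.π (edgeBoundary A) := by
    rw [← sub_eq_zero, ← Preadditive.sub_comp, cokernel.condition]
  rw [← map_op_comp_eq A hi, ← map_op_comp_eq A hj, Category.assoc, Category.assoc]
  exact congrArg (A.map (SimplexCategory.mkOfLe i j hij).op ≫ ·) hδ.symm

/-- The map which takes a simplex to the class of its initial vertex. -/
def toPi₀ : A ⟶ (SimplicialObject.const C).obj (pi₀ A) where
  app n := A.map (SimplexCategory.const ⦋0⦌ n.unop 0).op ≫ cokernel.π (edgeBoundary A)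
  naturality m n f := by
    have hf : A.map f ≫ A.map (SimplexCategory.const ⦋0⦌ n.unop 0).op =
        A.map (SimplexCategory.const ⦋0⦌ m.unop (f.unop.toOrderHom 0)).op :=
      map_op_comp_eq A (f := SimplexCategory.const ⦋0⦌ n.unop 0) (g := f.unop) rfl
    rw [← Category.assoc, hf]
    exact (map_const_comp_cokernel_π A _ _).trans (Category.comp_id _).symm

lemma proj_comp_toPi₀ :
    decalage.proj A ≫ toPi₀ A =
      decalage.augmentation A ≫ (SimplicialObject.const C).map (cokernel.π (edgeBoundary A)) := by
  ext n
  have h : A.map (simplexCone.incl.app n.unop).op ≫ A.map (SimplexCategory.const ⦋0⦌ n.unop 0).op =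
      A.map (SimplexCategory.const ⦋0⦌ ⦋n.unop.len + 1⦌ 1).op := map_op_comp_eq A rfl
  change A.map (simplexCone.incl.app n.unop).op ≫ A.map _ ≫ _ = _
  rw [← Category.assoc, h]
  exact map_const_comp_cokernel_π A 1 0

/-- A section of `toPi₀`, which represents a class by a degenerate simplex. -/
def ofPi₀ [Projective (pi₀ A)] : (SimplicialObject.const C).obj (pi₀ A) ⟶ A :=
  (SimplicialObject.const C).map (Projective.factorThru (𝟙 _) (cokernel.π (edgeBoundary A))) ≫
    decalage.degeneracy A ≫ decalage.proj A

lemma ofPi₀_comp_toPi₀ [Projective (pi₀ A)] : ofPi₀ A ≫ toPi₀ A = 𝟙 _ := by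
  rw [ofPi₀, Category.assoc, Category.assoc, proj_comp_toPi₀,
    ← Category.assoc (decalage.degeneracy A), decalage.degeneracy_comp_augmentation,
    Category.id_comp, ← Functor.map_comp, Projective.factorThru_comp, CategoryTheory.Functor.map_id]

/-- The part of `A` which vanishes in `π₀`. -/
abbrev base : SimplicialObject C := kernel (toPi₀ A)

/-- The path object: the simplices of the décalage whose cone point vanishes. -/
abbrev path : SimplicialObject C := kernel (decalage.augmentation A)

/-- The projection of the path object onto the part of `A` which vanishes in `π₀`. -/
abbrev pathToBase : path A ⟶ base A := kernel.map _ _ _ _ (proj_comp_toPi₀ A).symm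

/-- The loop object. -/
abbrev loop : SimplicialObject C := kernel (pathToBase A)

variable {A}

-- The edge `z` is replaced by `s₀ d₀ z - z`, which kills the end point and keeps the difference.
lemma exists_edge {T : C} (v : T ⟶ A _⦋0⦌) (hv : v ≫ cokernel.π (edgeBoundary A) = 0) :
    ∃ (T' : C) (q : T' ⟶ T) (_ : Epi q) (z : T' ⟶ A _⦋1⦌),
      z ≫ A.δ 0 = 0 ∧ z ≫ A.δ 1 = q ≫ v := by
  obtain ⟨T', q, hq, z : T' ⟶ A _⦋1⦌, hz : q ≫ v = z ≫ (A.δ 0 - A.δ 1)⟩ :=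
    (ShortComplex.cokernelSequence_exact (edgeBoundary A)).exact_up_to_refinements v hv
  have h₀ : A.σ 0 ≫ A.δ 0 = 𝟙 (A _⦋0⦌) := A.δ_comp_σ_self (i := 0)
  have h₁ : A.σ 0 ≫ A.δ 1 = 𝟙 (A _⦋0⦌) := A.δ_comp_σ_succ (i := 0)
  refine ⟨T', q, hq, (z ≫ A.δ 0) ≫ A.σ 0 - z, ?_, ?_⟩
  · rw [Preadditive.sub_comp, Category.assoc, h₀, Category.comp_id, sub_self]
  · rw [Preadditive.sub_comp, Category.assoc, h₁, Category.comp_id, hz, Preadditive.comp_sub]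

-- The simplex `s₀ x` lies over `x`, and its cone point is moved to `0` by a degenerate simplex.
lemma exists_comp_proj_eq {T : C} {k : ℕ} (x : T ⟶ A _⦋k⦌)
    (hx : x ≫ (toPi₀ A).app (op ⦋k⦌) = 0) :
    ∃ (T' : C) (q : T' ⟶ T) (_ : Epi q) (y : T' ⟶ (decalage A) _⦋k⦌),
      y ≫ (decalage.augmentation A).app (op ⦋k⦌) = 0 ∧
        y ≫ (decalage.proj A).app (op ⦋k⦌) = q ≫ x := by
  obtain ⟨T', q, hq, z, hz₀, hz₁⟩ := exists_edge
    (x ≫ A.map (SimplexCategory.const ⦋0⦌ ⦋k⦌ 0).op) ((Category.assoc _ _ _).trans hx)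
  let d : A _⦋1⦌ ⟶ A _⦋k + 1⦌ := A.map (simplexCone.map (SimplexCategory.const ⦋k⦌ ⦋0⦌ 0)).op
  have hd₀ : d ≫ A.δ 0 = A.δ 0 ≫ A.map (SimplexCategory.const ⦋k⦌ ⦋0⦌ 0).op :=
    map_op_comp_eq_map_op_comp A (f := SimplexCategory.δ 0) (f' := SimplexCategory.const ⦋k⦌ ⦋0⦌ 0)
      (g' := SimplexCategory.δ 0) rfl
  have hd₁ : d ≫ A.map (SimplexCategory.const ⦋0⦌ ⦋k + 1⦌ 0).op = A.δ 1 :=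
    map_op_comp_eq A (SimplexCategory.Hom.ext_zero_left _ _)
  have hs₀ : A.σ 0 ≫ A.δ 0 = 𝟙 (A _⦋k⦌) := A.δ_comp_σ_self (i := 0)
  have hs₁ : A.σ 0 ≫ A.map (SimplexCategory.const ⦋0⦌ ⦋k + 1⦌ 0).op =
      A.map (SimplexCategory.const ⦋0⦌ ⦋k⦌ 0).op := map_op_comp_eq A rfl
  refine ⟨T', q, hq, (q ≫ x) ≫ A.σ 0 - z ≫ d, ?_, ?_⟩
  · change (_ - _) ≫ A.map (SimplexCategory.const ⦋0⦌ ⦋k + 1⦌ 0).op = 0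
    rw [Preadditive.sub_comp, Category.assoc, Category.assoc z, hs₁, hd₁, hz₁, Category.assoc,
      sub_self]
  · change (_ - _) ≫ A.δ 0 = _
    rw [Preadditive.sub_comp, Category.assoc, Category.assoc z, hs₀, hd₀, ← Category.assoc z, hz₀,
      zero_comp, sub_zero, Category.comp_id]

lemma exists_comp_kernel_ι_app_eq {A B : SimplicialObject C} (f : A ⟶ B) (n : SimplexCategoryᵒᵖ)
    {T : C} (x : T ⟶ A.obj n) (hx : x ≫ f.app n = 0) :
    ∃ y : T ⟶ (kernel f).obj n, y ≫ (kernel.ι f).app n = x := by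
  let S := (ShortComplex.kernelSequence f).map ((evaluation SimplexCategoryᵒᵖ C).obj n)
  have hS : S.Exact := (ShortComplex.kernelSequence_exact f).map _
  have : Mono S.f := (NatTrans.mono_iff_mono_app (kernel.ι f)).1 inferInstance n
  exact ⟨hS.lift x hx, hS.lift_f x hx⟩

instance : Epi (pathToBase A) := by
  have (n : SimplexCategoryᵒᵖ) : Epi ((pathToBase A).app n) := by
    rw [epi_iff_surjective_up_to_refinements]
    intro T x
    have hx : (x ≫ (kernel.ι (toPi₀ A)).app n) ≫ (toPi₀ A).app n = 0 := by
      rw [Category.assoc, ← NatTrans.comp_app, kernel.condition, NatTrans.app_zero, comp_zero]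
    obtain ⟨T', q, hq, y, hy₀, hy⟩ := exists_comp_proj_eq _ hx
    obtain ⟨y', rfl⟩ := exists_comp_kernel_ι_app_eq _ _ y hy₀
    have : Mono ((kernel.ι (toPi₀ A)).app n) :=
      (NatTrans.mono_iff_mono_app (kernel.ι (toPi₀ A))).1 inferInstance n
    refine ⟨T', q, hq, y', ?_⟩
    rw [← cancel_mono ((kernel.ι (toPi₀ A)).app n), Category.assoc, Category.assoc,
      ← NatTrans.comp_app, kernel.lift_ι, NatTrans.comp_app, ← hy, Category.assoc]
  exact NatTrans.epi_of_epi_app _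

end Loop

/-! ### Homology of tensor products -/

section Homology

/-- The `n`-th homology of a simplicial object of an abelian category, as a functor. -/
def simplicialHomology (C : Type*) [Category* C] [Abelian C] (n : ℕ) : SimplicialObject C ⥤ C :=
  alternatingFaceMapComplex C ⋙ HomologicalComplex.homologyFunctor _ _ n

instance (C : Type*) [Category* C] [Abelian C] (n : ℕ) : (simplicialHomology C n).Additive := by
  unfold simplicialHomology
  infer_instance

/-- The product of two simplicial homotopies. -/
def homotopyProd {C D : Type*} [Category* C] [Category* D] {X X' : SimplicialObject C}
    {Y Y' : SimplicialObject D} {f g : X ⟶ X'} {f' g' : Y ⟶ Y'}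
    (H : SimplicialObject.Homotopy f g) (H' : SimplicialObject.Homotopy f' g') :
    SimplicialObject.Homotopy (C := C × D) (X := X.prod' Y) (Y := X'.prod' Y')
      (NatTrans.prod' f f') (NatTrans.prod' g g') where
  h i := (H.h i, H'.h i)
  h_zero_comp_δ_zero n := Prod.ext (H.h_zero_comp_δ_zero n) (H'.h_zero_comp_δ_zero n)
  h_last_comp_δ_last n := Prod.ext (H.h_last_comp_δ_last n) (H'.h_last_comp_δ_last n)
  h_succ_comp_δ_castSucc_of_lt i j hij :=
    Prod.ext (H.h_succ_comp_δ_castSucc_of_lt i j hij) (H'.h_succ_comp_δ_castSucc_of_lt i j hij)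
  h_succ_comp_δ_castSucc_succ j :=
    Prod.ext (H.h_succ_comp_δ_castSucc_succ j) (H'.h_succ_comp_δ_castSucc_succ j)
  h_castSucc_comp_δ_succ_of_lt i j hij :=
    Prod.ext (H.h_castSucc_comp_δ_succ_of_lt i j hij) (H'.h_castSucc_comp_δ_succ_of_lt i j hij)
  h_comp_σ_castSucc_of_le i j hij :=
    Prod.ext (H.h_comp_σ_castSucc_of_le i j hij) (H'.h_comp_σ_castSucc_of_le i j hij)
  h_comp_σ_succ_of_lt i j hij :=
    Prod.ext (H.h_comp_σ_succ_of_lt i j hij) (H'.h_comp_σ_succ_of_lt i j hij)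

end Homology

universe v

/-- Simplicial modules over a ring. -/
abbrev SimplicialModule (R : Type v) [Ring R] := SimplicialObject (ModuleCat.{u} R)

namespace SimplicialModule

section Tensor

variable {R : Type v} [CommRing R]

/-- The tensor product of modules as a functor of two variables. The monoidal structure of
`ModuleCat.{u} R` is not used, since it requires `R` to live in the universe `u`. -/
def tensorBifunctor (R : Type v) [CommRing R] :
    ModuleCat.{u} R × ModuleCat.{u} R ⥤ ModuleCat.{u} R where
  obj V := ModuleCat.of R (V.1 ⊗[R] V.2)
  map f := ModuleCat.ofHom (TensorProduct.map f.1.hom f.2.hom)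
  map_id _ := ModuleCat.hom_ext TensorProduct.map_id
  map_comp f g := ModuleCat.hom_ext (TensorProduct.map_comp g.1.hom g.2.hom f.1.hom f.2.hom)

/-- The levelwise tensor product with a fixed simplicial module, as a functor. -/
def tensorFunctor (B : SimplicialModule.{u} R) :
    SimplicialModule.{u} R ⥤ SimplicialModule.{u} R where
  obj A := A.prod' B ⋙ tensorBifunctor R
  map f := Functor.whiskerRight (NatTrans.prod' f (𝟙 B)) (tensorBifunctor R)
  map_id _ := Functor.whiskerRight_id' (tensorBifunctor R)
  map_comp f g := by
    rw [← Functor.whiskerRight_comp]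
    congr 1

/-- The levelwise tensor product of two simplicial modules. -/
abbrev tensor (A B : SimplicialModule.{u} R) : SimplicialModule.{u} R := (tensorFunctor B).obj A

instance (B : SimplicialModule.{u} R) : (tensorFunctor B).Additive where
  map_add {_ _ f g} := by
    ext n : 2
    exact LinearMap.rTensor_add (B.obj n) (f.app n).hom (g.app n).hom

/-- A simplicial homotopy tensored with the constant homotopy of the identity. -/
def homotopyTensor {A A' : SimplicialModule.{u} R} {f g : A ⟶ A'}
    (H : SimplicialObject.Homotopy f g) (B : SimplicialModule.{u} R) :
    SimplicialObject.Homotopy ((tensorFunctor B).map f) ((tensorFunctor B).map g) :=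
  (homotopyProd H (.refl (𝟙 B))).whiskerRight (tensorBifunctor R)

lemma isZero_homology_tensor_path (A B : SimplicialModule.{u} R) (n : ℕ) :
    Limits.IsZero ((simplicialHomology (ModuleCat.{u} R) n).obj (tensor (path A) B)) := by
  let T : SimplicialModule.{u} R ⥤ ModuleCat.{u} R := tensorFunctor B ⋙ simplicialHomology _ n
  have h : T.map (decalage.augmentation A ≫ decalage.degeneracy A) = 𝟙 _ :=
    ((homotopyTensor (decalage.contraction A) B).map_homology_eq n).trans (T.map_id _)
  exact isZero_map_kernel T (decalage.degeneracy_comp_augmentation A) h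

lemma shortExact_map_tensorFunctor {S : ShortComplex (SimplicialModule.{u} R)} (hS : S.ShortExact)
    (B : SimplicialModule.{u} R) [∀ n, Module.Flat R (B.obj n)] :
    (S.map (tensorFunctor B ⋙ alternatingFaceMapComplex _)).ShortExact := by
  refine HomologicalComplex.shortExact_of_degreewise_shortExact _ fun k => ?_
  have hk : (S.map ((evaluation _ _).obj (op ⦋k⦌))).ShortExact := hS.map_of_exact _
  have hexact : Function.Exact (S.f.app (op ⦋k⦌)).hom (S.g.app (op ⦋k⦌)).hom :=
    (ShortComplex.ShortExact.moduleCat_exact_iff_function_exact _).1 hk.exact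
  have hinj : Function.Injective (S.f.app (op ⦋k⦌)).hom :=
    (ModuleCat.mono_iff_injective _).1 hk.mono_f
  have hsurj : Function.Surjective (S.g.app (op ⦋k⦌)).hom :=
    (ModuleCat.epi_iff_surjective _).1 hk.epi_g
  apply ModuleCat.shortComplex_shortExact
  · exact rTensor_exact (B.obj (op ⦋k⦌)) hexact hsurj
  · exact Module.Flat.rTensor_preserves_injective_linearMap (M := B.obj (op ⦋k⦌)) _ hinj
  · exact LinearMap.rTensor_surjective (B.obj (op ⦋k⦌)) hsurj

/-- The tensor product with a fixed module, as a functor. -/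
def tensorLeft (V : ModuleCat.{u} R) : ModuleCat.{u} R ⥤ ModuleCat.{u} R :=
  Prod.sectR V _ ⋙ tensorBifunctor R

instance (V : ModuleCat.{u} R) : (tensorLeft V).Additive where
  map_add {_ _ f g} := by
    refine ModuleCat.hom_ext (R := R) ?_
    exact LinearMap.lTensor_add V f.hom g.hom

instance (V : ModuleCat.{u} R) [Module.Flat R V] : (tensorLeft V).PreservesHomology := by
  refine Functor.preservesHomology_of_map_exact _ fun S hS => ?_
  have hV := Module.Flat.lTensor_exact V
    ((ShortComplex.ShortExact.moduleCat_exact_iff_function_exact _).1 hS)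
  apply ModuleCat.shortComplex_exact
  exact hV

/-- The homology of the tensor product with a constant simplicial module. -/
def homologyTensorConstIso (V : ModuleCat.{u} R) [Module.Flat R V] (B : SimplicialModule.{u} R)
    (n : ℕ) :
    (simplicialHomology _ n).obj (tensor ((SimplicialObject.const _).obj V) B) ≅
      (tensorLeft V).obj ((simplicialHomology _ n).obj B) :=
  let e : (alternatingFaceMapComplex _).obj (tensor ((SimplicialObject.const _).obj V) B) ≅
      ((tensorLeft V).mapHomologicalComplex _).obj ((alternatingFaceMapComplex _).obj B) :=
    eqToIso (Functor.congr_obj (map_alternatingFaceMapComplex (tensorLeft V)) B).symm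
  (HomologicalComplex.homologyFunctor _ _ n).mapIso e ≪≫
    ShortComplex.mapHomologyIso (((alternatingFaceMapComplex _).obj B).sc n) (tensorLeft V)

end Tensor

section Rank

variable {K : Type v} [Field K]

/-- The dimension of the `n`-th homology of a simplicial vector space. -/
def homologyRank (A : SimplicialModule.{u} K) (n : ℕ) : Cardinal.{u} :=
  Module.rank K ((simplicialHomology (ModuleCat.{u} K) n).obj A)

lemma rank_eq_of_iso {V W : ModuleCat.{u} K} (e : V ≅ W) : Module.rank K V = Module.rank K W :=
  e.toLinearEquiv.rank_eq

lemma rank_eq_zero_of_isZero {V : ModuleCat.{u} K} (h : Limits.IsZero V) : Module.rank K V = 0 :=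
  have := ModuleCat.subsingleton_of_isZero h
  rank_subsingleton' K V

lemma homologyRank_eq_of_iso {A B : SimplicialModule.{u} K} (e : A ≅ B) (n : ℕ) :
    homologyRank A n = homologyRank B n :=
  rank_eq_of_iso ((simplicialHomology _ n).mapIso e)

lemma homologyRank_tensor_const (V : ModuleCat.{u} K) (B : SimplicialModule.{u} K) (n : ℕ) :
    homologyRank (tensor ((SimplicialObject.const _).obj V) B) n =
      Module.rank K V * homologyRank B n :=
  (rank_eq_of_iso (homologyTensorConstIso V B n)).trans (rank_tensorProduct' ..)

lemma homologyRank_const (V : ModuleCat.{u} K) (n : ℕ) :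
    homologyRank ((SimplicialObject.const _).obj V) n = if n = 0 then Module.rank K V else 0 := by
  have e := (HomologicalComplex.homologyFunctor _ _ n).mapIso (alternatingFaceMapComplexConst.app V)
  refine (rank_eq_of_iso e).trans ?_
  split_ifs with h
  · subst h
    exact rank_eq_of_iso (ChainComplex.alternatingConstHomologyZero V)
  · exact rank_eq_zero_of_isZero (ChainComplex.alternatingConst_exactAt V n h).isZero_homology

variable (A B : SimplicialModule.{u} K) (n : ℕ)

lemma homologyRank_tensor_eq_base_add :
    homologyRank (tensor A B) n =
      homologyRank (tensor (base A) B) n +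
        Module.rank K (pi₀ A : ModuleCat.{u} K) * homologyRank B n := by
  rw [← homologyRank_tensor_const]
  exact ModuleCat.free_shortExact_rank_add
    ((kernelSplitting (ofPi₀_comp_toPi₀ A)).map
      (tensorFunctor B ⋙ simplicialHomology _ n)).shortExact

lemma shortExact_tensor_loop :
    ((ShortComplex.kernelSequence (pathToBase A)).map
      (tensorFunctor B ⋙ alternatingFaceMapComplex _)).ShortExact :=
  shortExact_map_tensorFunctor
    (.mk' (ShortComplex.kernelSequence_exact _) inferInstance
      (inferInstanceAs (Epi (pathToBase A)))) B

lemma homologyRank_tensor_base_succ :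
    homologyRank (tensor (base A) B) (n + 1) = homologyRank (tensor (loop A) B) n :=
  rank_eq_of_iso ((shortExact_tensor_loop A B).δIso (n + 1) n (by simp)
    (isZero_homology_tensor_path A B _) (isZero_homology_tensor_path A B _))

lemma homologyRank_tensor_base_zero : homologyRank (tensor (base A) B) 0 = 0 := by
  have := (shortExact_tensor_loop A B).epi_g
  have := HomologicalComplex.epi_homologyMap_of_epi_of_not_rel
    ((ShortComplex.kernelSequence (pathToBase A)).map
      (tensorFunctor B ⋙ alternatingFaceMapComplex _)).g 0 (by simp)
  exact rank_eq_zero_of_isZero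
    (@Limits.IsZero.of_epi _ _ _ _ _ _ this (isZero_homology_tensor_path A B 0))

end Rank

section Künneth

variable {K : Type} [Field K]

/-- The ground field as a vector space in the universe `u`. -/
abbrev unitModule (K : Type) [Field K] : ModuleCat.{u} K := ModuleCat.of K (ULift.{u} K)

lemma rank_unitModule : Module.rank K (unitModule.{u} K) = 1 := by
  simp

variable (A B : SimplicialModule.{u} K)

lemma homologyRank_tensor_unit (n : ℕ) :
    homologyRank (tensor A ((SimplicialObject.const _).obj (unitModule.{u} K))) n =
      homologyRank A n := by
  refine homologyRank_eq_of_iso (NatIso.ofComponents (fun m => LinearEquiv.toModuleIso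
    ((TensorProduct.congr (LinearEquiv.refl K _) ULift.moduleEquiv).trans
      (TensorProduct.rid K (A.obj m)))) fun f => ?_) n
  refine ModuleCat.hom_ext (TensorProduct.ext' fun x y => ?_)
  exact (map_smul (A.map f).hom _ _).symm

lemma homologyRank_zero : homologyRank A 0 = Module.rank K (pi₀ A : ModuleCat.{u} K) := by
  rw [← homologyRank_tensor_unit, homologyRank_tensor_eq_base_add, homologyRank_tensor_base_zero,
    homologyRank_const, if_pos rfl, rank_unitModule, zero_add, mul_one]

lemma homologyRank_succ (n : ℕ) : homologyRank A (n + 1) = homologyRank (loop A) n := by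
  rw [← homologyRank_tensor_unit, homologyRank_tensor_eq_base_add, homologyRank_tensor_base_succ,
    homologyRank_const, if_neg n.succ_ne_zero, mul_zero, add_zero, homologyRank_tensor_unit]

theorem homologyRank_tensor (n : ℕ) :
    homologyRank (tensor A B) n =
      ∑ p ∈ Finset.HasAntidiagonal.antidiagonal n, homologyRank A p.1 * homologyRank B p.2 := by
  induction n generalizing A with
  | zero =>
    rw [homologyRank_tensor_eq_base_add, homologyRank_tensor_base_zero, zero_add,
      ← homologyRank_zero, Finset.Nat.antidiagonal_zero, Finset.sum_singleton]
  | succ n ih =>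
    rw [homologyRank_tensor_eq_base_add, homologyRank_tensor_base_succ, ih,
      Finset.Nat.antidiagonal_succ, Finset.sum_cons, Finset.sum_map, ← homologyRank_zero, add_comm]
    simp only [homologyRank_succ, Function.Embedding.prodMap, Function.Embedding.coeFn_mk,
      Function.Embedding.refl_apply, Prod.map]

end Künneth

section Singular

variable (K : Type) [Field K]

/-- The functor which takes a type to the vector space with this basis. In contrast to
`ModuleCat.free`, the field need not live in the universe of the types. -/
def free : Type u ⥤ ModuleCat.{u} K where
  obj X := ModuleCat.of K (X →₀ K)
  map f := ModuleCat.ofHom (Finsupp.lmapDomain K K f)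
  map_id _ := ModuleCat.hom_ext (Finsupp.lmapDomain_id K K)
  map_comp f g := ModuleCat.hom_ext (Finsupp.lmapDomain_comp K K f g)

/-- The line in a free module spanned by a basis vector. -/
def freeIncl {X : Type u} (x : X) : unitModule.{u} K ⟶ (free K).obj X :=
  ModuleCat.ofHom (Finsupp.lsingle (M := K) (R := K) x ∘ₗ
    (ULift.moduleEquiv : ULift.{u} K ≃ₗ[K] K).toLinearMap)

lemma free_hom_ext {X : Type u} {V : ModuleCat.{u} K} {f g : (free K).obj X ⟶ V}
    (h : ∀ x, freeIncl K x ≫ f = freeIncl K x ≫ g) : f = g :=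
  ModuleCat.hom_ext (Finsupp.lhom_ext fun x c =>
    LinearMap.congr_fun (congrArg ModuleCat.Hom.hom (h x)) (ULift.up c))

lemma freeIncl_map {X Y : Type u} (f : X ⟶ Y) (x : X) :
    freeIncl K x ≫ (free K).map f = freeIncl K (f x) := by
  ext
  exact Finsupp.mapDomain_single

/-- The map out of a free module given by maps out of the lines spanned by the basis. -/
def freeDesc {X : Type u} {V : ModuleCat.{u} K} (f : X → (unitModule.{u} K ⟶ V)) :
    (free K).obj X ⟶ V :=
  ModuleCat.ofHom (Finsupp.lsum K fun x =>
    (f x).hom ∘ₗ (ULift.moduleEquiv : ULift.{u} K ≃ₗ[K] K).symm.toLinearMap)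

lemma freeIncl_freeDesc {X : Type u} {V : ModuleCat.{u} K} (f : X → (unitModule.{u} K ⟶ V))
    (x : X) : freeIncl K x ≫ freeDesc K f = f x := by
  ext y
  exact Finsupp.lsum_single K _ x y.down

/-- A free module is the coproduct of the lines spanned by its basis vectors. -/
def freeIsCoproduct (X : Type u) :
    Limits.IsColimit (Limits.Cofan.mk ((free K).obj X) (freeIncl.{u} K (X := X))) :=
  Limits.Cofan.IsColimit.mk _ (fun s => freeDesc K s.inj) (fun s => freeIncl_freeDesc K s.inj)
    fun s _ hm => free_hom_ext K fun x => (hm x).trans (freeIncl_freeDesc K s.inj x).symm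

/-- The coproduct of copies of the ground field is the free module. -/
def sigmaIsoFree (X : Type u) : (∐ fun _ : X => unitModule.{u} K) ≅ (free K).obj X :=
  (Limits.coproductIsCoproduct _).coconePointUniqueUpToIso (freeIsCoproduct K X)

lemma ι_sigmaIsoFree_hom {X : Type u} (x : X) :
    Limits.Sigma.ι (fun _ : X => unitModule.{u} K) x ≫ (sigmaIsoFree K X).hom = freeIncl K x :=
  (Limits.coproductIsCoproduct _).comp_coconePointUniqueUpToIso_hom (freeIsCoproduct K X) ⟨x⟩

/-- Forming coproducts of copies of the ground field is forming free modules. -/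
def sigmaConstIsoFree : Limits.sigmaConst.obj (unitModule.{u} K) ≅ free.{u} K :=
  NatIso.ofComponents (sigmaIsoFree K) fun {X Y} f => Limits.Sigma.hom_ext _ _ fun x =>
    calc Limits.Sigma.ι (fun _ : X => unitModule.{u} K) x ≫
          (Limits.sigmaConst.obj (unitModule.{u} K)).map f ≫ (sigmaIsoFree K Y).hom
      _ = freeIncl K (f x) := by simp [ι_sigmaIsoFree_hom]
      _ = freeIncl K x ≫ (free K).map f := (freeIncl_map K f x).symm
      _ = Limits.Sigma.ι (fun _ : X => unitModule.{u} K) x ≫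
            (sigmaIsoFree K X).hom ≫ (free K).map f := by
        rw [← Category.assoc, ι_sigmaIsoFree_hom]

/-- The simplicial module of singular chains. -/
def singular (X : Type u) [TopologicalSpace X] : SimplicialModule.{u} K :=
  TopCat.toSSet.obj (TopCat.of X) ⋙ free K

/-- The singular chain complex is the alternating face map complex of the singular simplicial
module. -/
def rationalSingularChainsIso (X : Type u) [TopologicalSpace X] :
    rationalSingularChains X ≅ (alternatingFaceMapComplex _).obj (singular ℚ X) :=
  (alternatingFaceMapComplex (ModuleCat.{u} ℚ)).mapIso
    (Functor.isoWhiskerLeft (TopCat.toSSet.obj (TopCat.of X)) (sigmaConstIsoFree ℚ))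

/-- A singular simplex of a product is a pair of singular simplices. -/
def singularProdEquiv (X Y : Type u) [TopologicalSpace X] [TopologicalSpace Y]
    (n : SimplexCategoryᵒᵖ) :
    (TopCat.toSSet.obj (TopCat.of (X × Y))).obj n ≃
      (TopCat.toSSet.obj (TopCat.of X)).obj n × (TopCat.toSSet.obj (TopCat.of Y)).obj n where
  toFun s := ((TopCat.toSSet.map (TopCat.ofHom ContinuousMap.fst)).app n s,
    (TopCat.toSSet.map (TopCat.ofHom ContinuousMap.snd)).app n s)
  invFun p := ULift.up (TopCat.ofHom (p.1.down.hom.prodMk p.2.down.hom))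
  left_inv _ := rfl
  right_inv _ := rfl

/-- The singular chains on a product are, levelwise, the tensor product of the chains on the
factors. -/
def singularProdIso (X Y : Type u) [TopologicalSpace X] [TopologicalSpace Y] :
    singular K (X × Y) ≅ tensor (singular K X) (singular K Y) :=
  NatIso.ofComponents
    (fun n => LinearEquiv.toModuleIso
      ((Finsupp.domLCongr (singularProdEquiv X Y n)).trans (finsuppTensorFinsupp' K _ _).symm))
    fun {m n} f => free_hom_ext K fun s => by
      ext c
      change (finsuppTensorFinsupp' K _ _).symm (Finsupp.domLCongr _ (Finsupp.mapDomain _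
        (Finsupp.single s c.down))) = TensorProduct.map (Finsupp.lmapDomain K K _)
          (Finsupp.lmapDomain K K _) ((finsuppTensorFinsupp' K _ _).symm
            (Finsupp.domLCongr _ (Finsupp.single s c.down)))
      rw [Finsupp.mapDomain_single, Finsupp.domLCongr_single, Finsupp.domLCongr_single,
        finsuppTensorFinsupp'_symm_single_eq_single_one_tmul,
        finsuppTensorFinsupp'_symm_single_eq_single_one_tmul, TensorProduct.map_tmul,
        Finsupp.lmapDomain_apply, Finsupp.lmapDomain_apply, Finsupp.mapDomain_single,
        Finsupp.mapDomain_single]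
      rfl

/-- The singular simplicial module of a totally disconnected space is constant. -/
def singularConstIso (X : Type u) [TopologicalSpace X] [TotallyDisconnectedSpace X] :
    singular K X ≅ (SimplicialObject.const _).obj ((free K).obj X) :=
  Functor.isoWhiskerRight (TopCat.toSSetIsoConst (TopCat.of X)) (free K) ≪≫
    Functor.constComp _ _ _

end Singular

end SimplicialModule

/-! ### Poincaré polynomials -/

/-- The `n`-th rational Betti number of a space, as a cardinal. -/
def bettiRank (X : Type u) [TopologicalSpace X] (n : ℕ) : Cardinal.{u} :=
  Module.rank ℚ ((rationalSingularChains X).homology n)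

open SimplicialModule

lemma bettiRank_eq_homologyRank (X : Type u) [TopologicalSpace X] (n : ℕ) :
    bettiRank X n = homologyRank (singular ℚ X) n :=
  rank_eq_of_iso ((HomologicalComplex.homologyFunctor _ _ n).mapIso (rationalSingularChainsIso X))

lemma bettiRank_prod (X Y : Type u) [TopologicalSpace X] [TopologicalSpace Y] (n : ℕ) :
    bettiRank (X × Y) n =
      ∑ p ∈ Finset.HasAntidiagonal.antidiagonal n, bettiRank X p.1 * bettiRank Y p.2 := by
  simp only [bettiRank_eq_homologyRank]
  rw [homologyRank_eq_of_iso (singularProdIso ℚ X Y), homologyRank_tensor]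

lemma bettiRank_congr {X Y : Type u} [TopologicalSpace X] [TopologicalSpace Y] (e : X ≃ₜ Y)
    (n : ℕ) : bettiRank X n = bettiRank Y n :=
  rank_eq_of_iso ((HomologicalComplex.homologyFunctor _ _ n).mapIso
    (((AlgebraicTopology.singularChainComplexFunctor (ModuleCat.{u} ℚ)).obj
      (unitModule ℚ)).mapIso (TopCat.isoOfHomeo e)))

lemma bettiRank_of_totallyDisconnectedSpace (X : Type u) [TopologicalSpace X]
    [TotallyDisconnectedSpace X] (n : ℕ) :
    bettiRank X n = if n = 0 then Cardinal.mk X else 0 := by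
  rw [bettiRank_eq_homologyRank, homologyRank_eq_of_iso (singularConstIso ℚ X),
    homologyRank_const, show Module.rank ℚ ((free ℚ).obj X) = _ from rank_finsupp_self ℚ X,
    Cardinal.lift_id']

/-- `p` is the Poincaré polynomial of `X`: its coefficients are the Betti numbers of `X`. A space
has a Poincaré polynomial exactly if its total rational homology is finite-dimensional. -/
def IsPoincarePolynomial (X : Type u) [TopologicalSpace X] (p : Polynomial ℕ) : Prop :=
  ∀ k, bettiRank X k = (p.coeff k : Cardinal)

lemma hasFiniteRationalHomology_iff (X : Type u) [TopologicalSpace X] :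
    HasFiniteRationalHomology X ↔ ∃ p, IsPoincarePolynomial X p := by
  simp only [HasFiniteRationalHomology, IsPoincarePolynomial, bettiRank,
    ← Module.rank_lt_aleph0_iff, ← rank_zero_iff (R := ℚ)]
  constructor
  · rintro ⟨h, N, hN⟩
    refine ⟨∑ k ∈ Finset.range N, Polynomial.monomial k
      (Cardinal.toNat (Module.rank ℚ ((rationalSingularChains X).homology k))), fun k => ?_⟩
    rw [Polynomial.finsetSum_coeff]
    simp only [Polynomial.coeff_monomial, Finset.sum_ite_eq', Finset.mem_range]
    split_ifs with hk
    · exact (Cardinal.cast_toNat_of_lt_aleph0 (h k)).symm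
    · simpa using hN k (not_lt.1 hk)
  · rintro ⟨p, hp⟩
    refine ⟨fun k => hp k ▸ Cardinal.natCast_lt_aleph0, p.natDegree + 1, fun k hk => ?_⟩
    rw [hp, Polynomial.coeff_eq_zero_of_natDegree_lt (by omega), Nat.cast_zero]

namespace IsPoincarePolynomial

variable {X Y : Type u} [TopologicalSpace X] [TopologicalSpace Y] {p q : Polynomial ℕ}

lemma eulerCharacteristic_eq (hp : IsPoincarePolynomial X p) :
    eulerCharacteristic X = p.eval₂ (Nat.castRingHom ℤ) (-1) := by
  have hr (k : ℕ) : Module.finrank ℚ ((rationalSingularChains X).homology k) = p.coeff k :=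
    (congrArg Cardinal.toNat (hp k)).trans (Cardinal.toNat_natCast _)
  rw [eulerCharacteristic,
    HomologicalComplex.homologyEulerChar_eq_sum_finSet_of_finrankSupport_subset _
      (Finset.range (p.natDegree + 1)), Polynomial.eval₂_eq_sum_range]
  · refine Finset.sum_congr rfl fun k _ => ?_
    rw [hr, mul_comm]
    simp
  · rw [GradedObject.finrankSupport_subset_iff]
    intro k hk
    rw [hr, Polynomial.coeff_eq_zero_of_natDegree_lt (by simpa using hk)]

lemma prod (hp : IsPoincarePolynomial X p) (hq : IsPoincarePolynomial Y q) :
    IsPoincarePolynomial (X × Y) (p * q) := by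
  intro k
  rw [bettiRank_prod, Polynomial.coeff_mul]
  push_cast
  exact Finset.sum_congr rfl fun i _ => by rw [hp, hq]

lemma congr (hp : IsPoincarePolynomial X p) (e : X ≃ₜ Y) : IsPoincarePolynomial Y p :=
  fun k => (bettiRank_congr e k).symm.trans (hp k)

lemma one_of_unique [Unique X] : IsPoincarePolynomial X 1 := by
  intro k
  rw [bettiRank_of_totallyDisconnectedSpace, Polynomial.coeff_one]
  split_ifs <;> simp

lemma fin_pow (hp : IsPoincarePolynomial X p) (n : ℕ) :
    IsPoincarePolynomial (Fin n → X) (p ^ n) := by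
  induction n with
  | zero => exact (pow_zero p) ▸ one_of_unique
  | succ n ih =>
    rw [pow_succ']
    exact (hp.prod ih).congr
      { toEquiv := Fin.consEquiv fun _ : Fin (n + 1) => X
        continuous_toFun := by
          refine continuous_pi fun i => ?_
          induction i using Fin.cases with
          | zero => exact continuous_fst
          | succ i => exact (continuous_apply i).comp continuous_snd
        continuous_invFun :=
          (continuous_apply 0).prodMk (continuous_pi fun i => continuous_apply i.succ) }

lemma pi {ι : Type} [Fintype ι] (hp : IsPoincarePolynomial X p) :
    IsPoincarePolynomial (ι → X) (p ^ Fintype.card ι) :=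
  (hp.fin_pow _).congr (Homeomorph.piCongrLeft (Y := fun _ => X) (Fintype.equivFin ι).symm)

end IsPoincarePolynomial

end
noncomputable section

/-! ### Fixed points of tuples of permutations -/

lemma tupleGraph_adj {n m : ℕ} (π : Fin m → Equiv.Perm (Fin n)) (a b : Fin n) :
    (tupleGraph π).Adj a b ↔ a ≠ b ∧ ((∃ j, π j a = b) ∨ ∃ j, π j b = a) :=
  SimpleGraph.fromRel_adj _ _ _

lemma reachable_tupleGraph {n m : ℕ} (π : Fin m → Equiv.Perm (Fin n)) (j : Fin m) (i : Fin n) :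
    (tupleGraph π).Reachable i (π j i) := by
  by_cases h : i = π j i
  · rw [← h]
  · exact ((tupleGraph_adj π _ _).2 ⟨h, Or.inl ⟨j, rfl⟩⟩).reachable

lemma rel_of_reachable_tupleGraph {n m : ℕ} {π : Fin m → Equiv.Perm (Fin n)} (r : Setoid (Fin n))
    (hr : ∀ j a, r a (π j a)) {a b : Fin n} (h : (tupleGraph π).Reachable a b) : r a b := by
  obtain ⟨p⟩ := h
  induction p with
  | nil => exact r.refl' _
  | cons hadj _ ih =>
    refine r.trans' ?_ ih
    obtain ⟨-, ⟨j, rfl⟩ | ⟨j, rfl⟩⟩ := (tupleGraph_adj π _ _).1 hadj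
    · exact hr j _
    · exact r.symm' (hr j _)

lemma mem_simultaneousFixedPoints_iff {M : Type u} {n m : ℕ} (π : Fin m → Equiv.Perm (Fin n))
    (x : Fin n → M) :
    x ∈ simultaneousFixedPoints (Fin n → M) π ↔ ∀ j i, x (π j i) = x i := by
  refine forall_congr' fun j => funext_iff.trans ?_
  refine ((π j).forall_congr_right (q := fun i => (π j • x) i = x i)).symm.trans
    (forall_congr' fun i => ?_)
  change x ((π j)⁻¹ (π j i)) = _ ↔ _
  rw [Equiv.Perm.inv_def, Equiv.symm_apply_apply, eq_comm]

lemma eq_of_reachable_tupleGraph {M : Type u} {n m : ℕ} {π : Fin m → Equiv.Perm (Fin n)}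
    {x : Fin n → M} (hx : x ∈ simultaneousFixedPoints (Fin n → M) π) {a b : Fin n}
    (h : (tupleGraph π).Reachable a b) : x a = x b :=
  rel_of_reachable_tupleGraph (Setoid.ker x)
    (fun j a => ((mem_simultaneousFixedPoints_iff π x).1 hx j a).symm) h

/-- The simultaneous fixed points of a tuple of permutations of the factors of a power are the
functions on the set of components. -/
def fixedPointsHomeomorph (M : Type u) [TopologicalSpace M] {n m : ℕ}
    (π : Fin m → Equiv.Perm (Fin n)) :
    ((tupleGraph π).ConnectedComponent → M) ≃ₜ simultaneousFixedPoints (Fin n → M) π where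
  toFun y := ⟨fun i => y ((tupleGraph π).connectedComponentMk i), by
    rw [mem_simultaneousFixedPoints_iff]
    intro j i
    rw [SimpleGraph.ConnectedComponent.sound (reachable_tupleGraph π j i)]⟩
  invFun x c := x.1 (Quot.out c)
  left_inv y := funext fun c => congrArg y (Quot.out_eq c)
  right_inv x := Subtype.ext <| funext fun i => eq_of_reachable_tupleGraph x.2
    (SimpleGraph.ConnectedComponent.exact (Quot.out_eq ((tupleGraph π).connectedComponentMk i)))
  continuous_toFun := Continuous.subtype_mk (continuous_pi fun _ => continuous_apply _) _
  continuous_invFun := continuous_pi fun c => (continuous_apply _).comp continuous_subtype_val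

lemma IsPoincarePolynomial.fixedPoints {M : Type u} [TopologicalSpace M] {p : Polynomial ℕ}
    (hp : IsPoincarePolynomial M p) {n m : ℕ} (π : Fin m → Equiv.Perm (Fin n)) :
    IsPoincarePolynomial (simultaneousFixedPoints (Fin n → M) π) (p ^ numComponents π) := by
  let := Fintype.ofFinite (tupleGraph π).ConnectedComponent
  rw [numComponents, Nat.card_eq_fintype_card]
  exact hp.pi.congr (fixedPointsHomeomorph M π)

lemma orbifoldGeneratingFunction_eq {M : Type u} [TopologicalSpace M]
    (hM : HasFiniteRationalHomology M) (m : ℕ) :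
    orbifoldGeneratingFunction M m = PowerSeries.mk fun n => (1 / (n.factorial : ℚ)) *
        ∑ π ∈ commutingTuples (Equiv.Perm (Fin n)) m,
          (eulerCharacteristic M : ℚ) ^ numComponents π := by
  obtain ⟨p, hp⟩ := (hasFiniteRationalHomology_iff M).1 hM
  refine congrArg PowerSeries.mk (funext fun n => ?_)
  rw [orbifoldEulerCharacteristic, Fintype.card_perm, Fintype.card_fin]
  refine congrArg _ (Finset.sum_congr rfl fun π _ => ?_)
  rw [(hp.fixedPoints π).eulerCharacteristic_eq, hp.eulerCharacteristic_eq, Polynomial.eval₂_pow,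
    Int.cast_pow]

/-! ### Orbits of permutation actions -/

/-- The orbit equivalence relation of the action given by a homomorphism to a permutation group. -/
def orbitSetoid {G α : Type*} [Group G] (φ : G →* Equiv.Perm α) : Setoid α :=
  MulAction.orbitRel φ.range α

lemma orbitSetoid_iff {G α : Type*} [Group G] (φ : G →* Equiv.Perm α) (a b : α) :
    orbitSetoid φ a b ↔ ∃ g, φ g a = b := by
  rw [Setoid.comm', orbitSetoid, MulAction.orbitRel_apply, MulAction.mem_orbit_iff]
  exact φ.rangeRestrict_surjective.exists

/-- The number of orbits of the action given by a homomorphism to a permutation group. -/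
def numOrbits {G α : Type*} [Group G] (φ : G →* Equiv.Perm α) : ℕ :=
  Nat.card (Quotient (orbitSetoid φ))

instance finite_monoidHom (G H : Type*) [Group G] [Group.FG G] [Group H] [Finite H] :
    Finite (G →* H) := by
  obtain ⟨S, hS⟩ := Group.FG.out (G := G)
  refine Finite.of_injective (fun (φ : G →* H) (s : S) => φ s) fun φ ψ h => ?_
  exact MonoidHom.eq_of_eqOn_dense hS fun s hs => congrFun h ⟨s, hs⟩

instance fintype_monoidHom (G H : Type*) [Group G] [Group.FG G] [Group H] [Finite H] :
    Fintype (G →* H) := Fintype.ofFinite _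

/-- The sum over the actions of `G` on `α` of `x` to the number of orbits. -/
def orbitSum (G α : Type*) [Group G] [Group.FG G] [Finite α] (x : ℚ) : ℚ :=
  ∑ φ : G →* Equiv.Perm α, x ^ numOrbits φ

/-! ### Commuting tuples and homomorphisms from a free abelian group -/

/-- The free abelian group `ℤ ^ m`, written multiplicatively. -/
abbrev IntPow (m : ℕ) : Type := Fin m → Multiplicative ℤ

section

variable {H : Type*} [Group H] {m : ℕ}

lemma pairwise_commute_zpowersHom_iff (g : Fin m → H) :
    (∀ i j, Commute (g i) (g j)) ↔
      Pairwise fun i j => ∀ x y, Commute (zpowersHom H (g i) x) (zpowersHom H (g j) y) := by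
  refine ⟨fun h i j _ x y => (h i j).zpow_zpow _ _, fun h i j => ?_⟩
  by_cases hij : i = j
  · rw [hij]
  · simpa using h hij (Multiplicative.ofAdd 1) (Multiplicative.ofAdd 1)

variable (H m) in
/-- A commuting `m`-tuple is the same as a homomorphism from `ℤ ^ m`. -/
def commutingTupleEquiv :
    {g : Fin m → H // ∀ i j, Commute (g i) (g j)} ≃ (IntPow m →* H) :=
  ((Equiv.piCongrRight fun _ => zpowersHom H).subtypeEquiv pairwise_commute_zpowersHom_iff).trans
    (MonoidHom.noncommPiCoprodEquiv (N := fun _ : Fin m => Multiplicative ℤ) (M := H))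

variable (g : {g : Fin m → H // ∀ i j, Commute (g i) (g j)})

lemma commutingTupleEquiv_mulSingle (i : Fin m) :
    commutingTupleEquiv H m g (Pi.mulSingle i (Multiplicative.ofAdd 1)) = g.1 i := by
  refine (MonoidHom.noncommPiCoprod_mulSingle (N := fun _ : Fin m => Multiplicative ℤ)
    (fun i => zpowersHom H (g.1 i))
    (hcomm := (pairwise_commute_zpowersHom_iff g.1).1 g.2) i (Multiplicative.ofAdd 1)).trans ?_
  rw [zpowersHom_apply, toAdd_ofAdd, zpow_one]

lemma commutingTupleEquiv_mem (S : Subgroup H) (hS : ∀ i, g.1 i ∈ S) (v : IntPow m) :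
    commutingTupleEquiv H m g v ∈ S :=
  Subgroup.noncommProd_mem S (t := Finset.univ) (f := fun i => zpowersHom H (g.1 i) (v i))
    (fun i _ j _ _ => (g.2 i j).zpow_zpow _ _) fun i _ => S.zpow_mem (hS i) _

end

lemma orbitSetoid_commutingTupleEquiv_iff {n m : ℕ}
    (π : {g : Fin m → Equiv.Perm (Fin n) // ∀ i j, Commute (g i) (g j)}) (a b : Fin n) :
    orbitSetoid (commutingTupleEquiv _ m π) a b ↔ (tupleGraph π.1).Reachable a b := by
  refine ⟨fun h => ?_, rel_of_reachable_tupleGraph _ fun j a => ?_⟩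
  · obtain ⟨v, rfl⟩ := (orbitSetoid_iff _ _ _).1 h
    let S : Subgroup (Equiv.Perm (Fin n)) :=
      { carrier := {σ | ∀ a, (tupleGraph π.1).Reachable a (σ a)}
        one_mem' := fun a => SimpleGraph.Reachable.refl _
        mul_mem' := fun {σ τ} hσ hτ a => (hτ a).trans (hσ (τ a))
        inv_mem' := fun {σ} hσ a => by simpa using (hσ (σ⁻¹ a)).symm }
    exact commutingTupleEquiv_mem π S (fun i a => reachable_tupleGraph _ _ _) v a
  · exact (orbitSetoid_iff _ _ _).2 ⟨_, by rw [commutingTupleEquiv_mulSingle]⟩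

lemma numOrbits_commutingTupleEquiv {n m : ℕ}
    (π : {g : Fin m → Equiv.Perm (Fin n) // ∀ i j, Commute (g i) (g j)}) :
    numOrbits (commutingTupleEquiv _ m π) = numComponents π.1 :=
  Nat.card_congr (Quot.congrRight (orbitSetoid_commutingTupleEquiv_iff π))

lemma sum_commutingTuples (n m : ℕ) (x : ℚ) :
    ∑ π ∈ commutingTuples (Equiv.Perm (Fin n)) m, x ^ numComponents π =
      orbitSum (IntPow m) (Fin n) x := by
  classical
  rw [orbitSum, ← (commutingTupleEquiv (Equiv.Perm (Fin n)) m).sum_comp]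
  simp only [numOrbits_commutingTupleEquiv]
  refine Finset.sum_subtype _ (fun π => ?_) _
  rw [commutingTuples, Finset.mem_filter_univ]

/-! ### Transitive actions and subgroups of finite index -/

/-- The number of subgroups of index `n`; the value is `0` if there are infinitely many. -/
def subgroupCount (G : Type*) [Group G] (n : ℕ) : ℕ :=
  Nat.card {H : Subgroup G // H.index = n}

/-- The transitive actions of `G` on `α`, as homomorphisms to the permutation group. -/
abbrev TransitiveHom (G α : Type*) [Group G] : Type _ :=
  {φ : G →* Equiv.Perm α // ∀ a b, ∃ g, φ g a = b}

section

variable {G α : Type*} [Group G]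

lemma transitive_of_forall_exists_apply_eq {φ : G →* Equiv.Perm α} {a₀ : α}
    (h : ∀ a, ∃ g, φ g a₀ = a) (a b : α) : ∃ g, φ g a = b := by
  obtain ⟨g, rfl⟩ := h a
  obtain ⟨k, rfl⟩ := h b
  exact ⟨k * g⁻¹, by rw [← Equiv.Perm.mul_apply, ← map_mul, inv_mul_cancel_right]⟩

/-- The action on `α` obtained by identifying it with a coset space. -/
def cosetHom (H : Subgroup G) (e : G ⧸ H ≃ α) : G →* Equiv.Perm α :=
  e.permCongrHom.toMonoidHom.comp (MulAction.toPermHom G (G ⧸ H))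

lemma cosetHom_apply (H : Subgroup G) (e : G ⧸ H ≃ α) (g : G) (x : G ⧸ H) :
    cosetHom H e g (e x) = e (g • x) := by
  change e (g • e.symm (e x)) = _
  rw [Equiv.symm_apply_apply]

lemma cosetHom_apply_one (H : Subgroup G) (e : G ⧸ H ≃ α) (g : G) :
    cosetHom H e g (e (1 : G)) = e (g : G) := by
  rw [cosetHom_apply, MulAction.Quotient.smul_coe, smul_eq_mul, mul_one]

/-- The transitive action with a base point given by a subgroup and a labelling of its cosets;
the base point is the label of the subgroup itself. -/
def pointedTransitiveHom (x : Σ H : Subgroup G, (G ⧸ H ≃ α)) : TransitiveHom G α × α :=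
  (⟨cosetHom x.1 x.2, transitive_of_forall_exists_apply_eq (a₀ := x.2 (1 : G)) fun a => by
      obtain ⟨c, rfl⟩ := x.2.surjective a
      obtain ⟨c, rfl⟩ := QuotientGroup.mk_surjective c
      exact ⟨c, cosetHom_apply_one _ _ c⟩⟩,
    x.2 (1 : G))

lemma pointedTransitiveHom_injective :
    Function.Injective (pointedTransitiveHom (G := G) (α := α)) := by
  rintro ⟨H, e⟩ ⟨H', e'⟩ h
  have haction : cosetHom H e = cosetHom H' e' := congrArg (fun z => z.1.1) h
  have hbase : e (1 : G) = e' (1 : G) := congrArg (fun z => z.2) h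
  have hlabel : ∀ g : G, e g = e' g := fun g => by
    rw [← cosetHom_apply_one H e g, ← cosetHom_apply_one H' e' g, haction, hbase]
  have hmem : ∀ (K : Subgroup G) (f : G ⧸ K ≃ α) (g : G), g ∈ K ↔ f g = f (1 : G) := by
    intro K f g
    rw [f.injective.eq_iff, eq_comm, QuotientGroup.eq, inv_one, one_mul]
  obtain rfl : H = H' := by
    ext g
    rw [hmem H e, hmem H' e', hlabel, hlabel]
  congr 1
  ext x
  induction x using QuotientGroup.induction_on with
  | H g => exact hlabel g

lemma pointedTransitiveHom_surjective :
    Function.Surjective (pointedTransitiveHom (G := G) (α := α)) := by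
  rintro ⟨⟨φ, hφ⟩, a⟩
  let : MulAction G α := MulAction.compHom α φ
  let e : G ⧸ MulAction.stabilizer G a ≃ α :=
    Equiv.ofBijective (MulAction.ofQuotientStabilizer G a)
      ⟨MulAction.injective_ofQuotientStabilizer G a, fun b => by
        obtain ⟨g, hg⟩ := hφ a b
        exact ⟨(g : G), hg⟩⟩
  have he : ∀ g : G, e g = φ g a := fun g => rfl
  refine ⟨⟨_, e⟩, Prod.ext (Subtype.ext (MonoidHom.ext fun g => Equiv.ext fun b => ?_)) ?_⟩
  · obtain ⟨c, rfl⟩ := e.surjective b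
    induction c using QuotientGroup.induction_on with
    | H c =>
      change cosetHom _ e g (e c) = φ g (e c)
      rw [cosetHom_apply, MulAction.Quotient.smul_coe, he, he, smul_eq_mul, map_mul,
        Equiv.Perm.mul_apply]
  · change e (1 : G) = a
    rw [he, map_one, Equiv.Perm.one_apply]

variable (G α) in
/-- Transitive actions on `α` with a base point are the same as subgroups whose index is the
number of elements of `α`, together with a labelling of the cosets. -/
def sigmaCosetEquiv :
    (Σ H : {H : Subgroup G // H.index = Nat.card α}, (G ⧸ H.1 ≃ α)) ≃ TransitiveHom G α × α :=
  (Equiv.sigmaSubtypeEquivOfSubset (fun H : Subgroup G => (G ⧸ H ≃ α))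
    (fun H => H.index = Nat.card α) fun _ e => Nat.card_congr e).trans
  (Equiv.ofBijective pointedTransitiveHom
    ⟨pointedTransitiveHom_injective, pointedTransitiveHom_surjective⟩)

lemma nonempty_quotient_equiv [Finite α] [Nonempty α] {H : Subgroup G}
    (hH : H.index = Nat.card α) : Nonempty (G ⧸ H ≃ α) := by
  have : H.FiniteIndex := ⟨by rw [hH]; exact Nat.card_pos.ne'⟩
  exact Finite.card_eq.1 hH

lemma finite_subgroup_index [Group.FG G] {n : ℕ} (hn : n ≠ 0) :
    Finite {H : Subgroup G // H.index = n} := by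
  have : NeZero n := ⟨hn⟩
  have := Finite.of_injective _ (sigmaCosetEquiv G (Fin n)).injective
  rw [← Nat.card_fin n]
  refine Finite.of_surjective (Sigma.fst : (Σ H : {H : Subgroup G // H.index = Nat.card (Fin n)},
    (G ⧸ H.1 ≃ Fin n)) → _) fun H => ?_
  obtain ⟨e⟩ := nonempty_quotient_equiv H.2
  exact ⟨⟨H, e⟩, rfl⟩

lemma card_transitiveHom [Group.FG G] [Finite α] [Nonempty α] :
    Nat.card (TransitiveHom G α) = (Nat.card α - 1).factorial * subgroupCount G (Nat.card α) := by
  have : Finite {H : Subgroup G // H.index = Nat.card α} := finite_subgroup_index Nat.card_pos.ne'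
  let := Fintype.ofFinite {H : Subgroup G // H.index = Nat.card α}
  have labelling : ∀ H : {H : Subgroup G // H.index = Nat.card α},
      Nonempty ((G ⧸ H.1 ≃ α) ≃ (α ≃ α)) := fun H =>
    (nonempty_quotient_equiv H.2).map fun e => e.equivCongr (Equiv.refl α)
  have := fun H => Finite.of_equiv _ (labelling H).some.symm
  have hcard : ∀ H : {H : Subgroup G // H.index = Nat.card α},
      Nat.card (G ⧸ H.1 ≃ α) = (Nat.card α).factorial := fun H => by
    rw [Nat.card_congr (labelling H).some, ← Nat.card_perm]
  have h := Nat.card_congr (sigmaCosetEquiv G α)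
  rw [Nat.card_sigma, Finset.sum_congr rfl fun H _ => hcard H, Finset.sum_const, Finset.card_univ,
    Nat.card_prod, ← Nat.card_eq_fintype_card, ← subgroupCount, smul_eq_mul,
    ← Nat.mul_factorial_pred Nat.card_pos.ne'] at h
  refine Nat.eq_of_mul_eq_mul_right (Nat.card_pos (α := α)) ?_
  rw [← h]
  ring

end

/-! ### Subgroups of a product with an infinite cyclic group -/

lemma index_eq_relIndex_ker_mul_index_map {G G' : Type*} [Group G] [Group G'] (L : Subgroup G)
    [L.Normal] {f : G →* G'} (hf : Function.Surjective f) :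
    L.index = L.relIndex f.ker * (L.map f).index := by
  rw [Subgroup.index_map, MonoidHom.range_eq_top.2 hf, Subgroup.index_top, mul_one,
    ← Subgroup.relIndex_mul_index (le_sup_left : L ≤ L ⊔ f.ker), Subgroup.relIndex_sup_left]

lemma index_eq_index_comap_inl_mul_index_map_snd {G A : Type*} [Group G] [Group A]
    (L : Subgroup (G × A)) [L.Normal] :
    L.index = (L.comap (MonoidHom.inl G A)).index * (L.map (MonoidHom.snd G A)).index := by
  have hrange : (MonoidHom.inl G A).range = (MonoidHom.snd G A).ker := by
    ext ⟨g, a⟩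
    simp [Subgroup.mem_prod, eq_comm]
  rw [Subgroup.index_comap, hrange]
  exact index_eq_relIndex_ker_mul_index_map L Prod.snd_surjective

lemma index_zpowers_ofAdd (e : ℕ) :
    (Subgroup.zpowers (Multiplicative.ofAdd (e : ℤ))).index = e := by
  have h := Int.index_zmultiples (e : ℤ)
  rwa [Int.natAbs_natCast, ← AddSubgroup.index_toSubgroup] at h

lemma eq_zpowers_index (L : Subgroup (Multiplicative ℤ)) :
    L = Subgroup.zpowers (Multiplicative.ofAdd (L.index : ℤ)) := by
  obtain ⟨a, rfl⟩ := Subgroup.isCyclic_iff_exists_zpowers_eq_top L |>.1 inferInstance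
  have : Subgroup.zpowers a = Subgroup.zpowers (Multiplicative.ofAdd (a.toAdd.natAbs : ℤ)) :=
    congrArg AddSubgroup.toSubgroup (Int.zmultiples_natAbs a.toAdd).symm
  rw [this, index_zpowers_ofAdd]

lemma ofAdd_natCast_zpow (e : ℕ) (j : ℤ) :
    Multiplicative.ofAdd (e : ℤ) ^ j = Multiplicative.ofAdd (j * e) := by
  rw [← ofAdd_zsmul, smul_eq_mul]

section

variable {G : Type*} [CommGroup G]

/-- The subgroup of `G × ℤ` generated by `K × 0` and a lift of `(w, e)`. -/
def cyclicExtension (K : Subgroup G) (e : ℕ) (w : G ⧸ K) : Subgroup (G × Multiplicative ℤ) :=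
  (Subgroup.zpowers (w, Multiplicative.ofAdd (e : ℤ))).comap
    ((QuotientGroup.mk' K).prodMap (MonoidHom.id (Multiplicative ℤ)))

lemma mem_cyclicExtension (K : Subgroup G) (e : ℕ) (w : G ⧸ K) (g : G) (t : Multiplicative ℤ) :
    (g, t) ∈ cyclicExtension K e w ↔ ∃ j : ℤ, w ^ j = g ∧ Multiplicative.ofAdd (j * e) = t := by
  rw [cyclicExtension, Subgroup.mem_comap, Subgroup.mem_zpowers_iff]
  simp only [Prod.ext_iff, Prod.pow_fst, Prod.pow_snd, ofAdd_natCast_zpow]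
  rfl

lemma comap_inl_cyclicExtension (K : Subgroup G) {e : ℕ} (he : e ≠ 0) (w : G ⧸ K) :
    (cyclicExtension K e w).comap (MonoidHom.inl G (Multiplicative ℤ)) = K := by
  ext g
  refine (mem_cyclicExtension K e w g 1).trans ⟨?_, fun hg => ?_⟩
  · rintro ⟨j, hj, h⟩
    obtain rfl : j = 0 := by simpa [he] using h
    rw [zpow_zero] at hj
    exact (QuotientGroup.eq_one_iff g).1 hj.symm
  · exact ⟨0, by rw [zpow_zero, (QuotientGroup.eq_one_iff g).2 hg], by rw [zero_mul, ofAdd_zero]⟩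

lemma map_snd_cyclicExtension (K : Subgroup G) (e : ℕ) (w : G ⧸ K) :
    (cyclicExtension K e w).map (MonoidHom.snd G (Multiplicative ℤ)) =
      Subgroup.zpowers (Multiplicative.ofAdd (e : ℤ)) := by
  ext t
  simp only [Subgroup.mem_map, Subgroup.mem_zpowers_iff, ofAdd_natCast_zpow]
  constructor
  · rintro ⟨⟨g, s⟩, h, rfl⟩
    obtain ⟨j, -, hj⟩ := (mem_cyclicExtension K e w g s).1 h
    exact ⟨j, hj⟩
  · rintro ⟨j, rfl⟩
    obtain ⟨g, hg⟩ := QuotientGroup.mk_surjective (w ^ j)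
    exact ⟨(g, _), (mem_cyclicExtension K e w g _).2 ⟨j, hg.symm, rfl⟩, rfl⟩

lemma cyclicExtension_injective (K : Subgroup G) {e : ℕ} (he : e ≠ 0) :
    Function.Injective (cyclicExtension K e) := by
  intro w w' h
  obtain ⟨g, rfl⟩ := QuotientGroup.mk_surjective w
  have hg : (g, Multiplicative.ofAdd (e : ℤ)) ∈ cyclicExtension K e (g : G ⧸ K) :=
    (mem_cyclicExtension _ _ _ _ _).2 ⟨1, zpow_one _, by rw [one_mul]⟩
  rw [h, mem_cyclicExtension] at hg
  obtain ⟨j, hj, hje⟩ := hg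
  obtain rfl : j = 1 :=
    mul_right_cancel₀ (Nat.cast_ne_zero.2 he) ((Multiplicative.ofAdd.injective hje).trans
      (one_mul _).symm)
  rw [← hj, zpow_one]

lemma mk_mem_iff_mk_zpow_eq {L : Subgroup (G × Multiplicative ℤ)} {g : G} {e : ℕ}
    (hg : (g, Multiplicative.ofAdd (e : ℤ)) ∈ L) (x : G) (j : ℤ) :
    (x, Multiplicative.ofAdd (j * e)) ∈ L ↔
      (g : G ⧸ L.comap (MonoidHom.inl G (Multiplicative ℤ))) ^ j = x := by
  have hpow : (g ^ j, Multiplicative.ofAdd (j * (e : ℤ))) ∈ L := by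
    have := L.zpow_mem hg j
    rwa [Prod.pow_mk, ofAdd_natCast_zpow] at this
  have hx : (g ^ j, Multiplicative.ofAdd (j * (e : ℤ))) *
      MonoidHom.inl G (Multiplicative ℤ) ((g ^ j)⁻¹ * x) =
      (x, Multiplicative.ofAdd (j * (e : ℤ))) := by
    rw [MonoidHom.inl_apply, Prod.mk_mul_mk, mul_one, mul_inv_cancel_left]
  rw [← QuotientGroup.mk_zpow, QuotientGroup.eq, Subgroup.mem_comap, ← hx,
    L.mul_mem_cancel_left hpow]

lemma exists_cyclicExtension_eq (L : Subgroup (G × Multiplicative ℤ)) :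
    ∃ w, cyclicExtension (L.comap (MonoidHom.inl G (Multiplicative ℤ)))
      (L.map (MonoidHom.snd G (Multiplicative ℤ))).index w = L := by
  have hmap := eq_zpowers_index (L.map (MonoidHom.snd G (Multiplicative ℤ)))
  set e := (L.map (MonoidHom.snd G (Multiplicative ℤ))).index
  obtain ⟨⟨g, s⟩, hg, rfl : s = _⟩ :
      Multiplicative.ofAdd (e : ℤ) ∈ L.map (MonoidHom.snd G (Multiplicative ℤ)) := by
    rw [hmap]
    exact Subgroup.mem_zpowers _
  refine ⟨g, ?_⟩
  ext ⟨x, t⟩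
  refine (mem_cyclicExtension _ e _ x t).trans ⟨?_, fun h => ?_⟩
  · rintro ⟨j, hj, rfl⟩
    exact (mk_mem_iff_mk_zpow_eq hg x j).2 hj
  · have ht : t ∈ L.map (MonoidHom.snd G (Multiplicative ℤ)) := ⟨_, h, rfl⟩
    rw [hmap, Subgroup.mem_zpowers_iff] at ht
    obtain ⟨j, rfl⟩ := ht
    rw [ofAdd_natCast_zpow] at h ⊢
    exact ⟨j, (mk_mem_iff_mk_zpow_eq hg x j).1 h, rfl⟩

lemma index_cyclicExtension (K : Subgroup G) {e : ℕ} (he : e ≠ 0) (w : G ⧸ K) :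
    (cyclicExtension K e w).index = K.index * e := by
  rw [index_eq_index_comap_inl_mul_index_map_snd, comap_inl_cyclicExtension K he,
    map_snd_cyclicExtension, index_zpowers_ofAdd]

lemma div_ne_zero_of_mem_divisors {d n : ℕ} (hd : d ∈ n.divisors) : n / d ≠ 0 :=
  (Nat.div_pos (Nat.divisor_le hd) (Nat.pos_of_mem_divisors hd)).ne'

variable (G) in
/-- The subgroup of index `n` of `G × ℤ` given by a subgroup of `G` whose index `d` divides `n`
and one of its `d` cosets. -/
def cyclicExtensionMap (n : ℕ)
    (x : Σ d : n.divisors, Σ K : {K : Subgroup G // K.index = d}, G ⧸ K.1) :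
    {L : Subgroup (G × Multiplicative ℤ) // L.index = n} :=
  ⟨cyclicExtension x.2.1.1 (n / x.1) x.2.2, by
    rw [index_cyclicExtension _ (div_ne_zero_of_mem_divisors x.1.2), x.2.1.2,
      Nat.mul_div_cancel' (Nat.dvd_of_mem_divisors x.1.2)]⟩

lemma cyclicExtensionMap_injective (n : ℕ) : Function.Injective (cyclicExtensionMap G n) := by
  rintro ⟨⟨d, hd⟩, ⟨K, hK : K.index = d⟩, w⟩ ⟨⟨d', hd'⟩, ⟨K', hK' : K'.index = d'⟩, w'⟩ h
  have h : cyclicExtension K (n / d) w = cyclicExtension K' (n / d') w' := congrArg Subtype.val h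
  obtain rfl : K = K' := by
    rw [← comap_inl_cyclicExtension K (div_ne_zero_of_mem_divisors hd) w,
      ← comap_inl_cyclicExtension K' (div_ne_zero_of_mem_divisors hd') w', h]
  subst hK hK'
  rw [cyclicExtension_injective K (div_ne_zero_of_mem_divisors hd) h]

lemma cyclicExtensionMap_surjective {n : ℕ} (hn : n ≠ 0) :
    Function.Surjective (cyclicExtensionMap G n) := by
  rintro ⟨L, rfl⟩
  obtain ⟨w, hw⟩ := exists_cyclicExtension_eq L
  have hindex := index_eq_index_comap_inl_mul_index_map_snd L
  refine ⟨⟨⟨_, Nat.mem_divisors.2 ⟨⟨_, hindex⟩, hn⟩⟩, ⟨_, rfl⟩, w⟩, Subtype.ext ?_⟩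
  refine Eq.trans ?_ hw
  change cyclicExtension _ (L.index / _) w = _
  congr 1
  exact Nat.div_eq_of_eq_mul_right
    (Nat.pos_of_ne_zero (left_ne_zero_of_mul (hindex.symm.trans_ne hn))) hindex

lemma subgroupCount_prod [Group.FG G] {n : ℕ} (hn : n ≠ 0) :
    subgroupCount (G × Multiplicative ℤ) n = ∑ d ∈ n.divisors, d * subgroupCount G d := by
  have hd : ∀ d : n.divisors, (d : ℕ) ≠ 0 := fun d => (Nat.pos_of_mem_divisors d.2).ne'
  have := fun d : n.divisors => finite_subgroup_index (G := G) (hd d)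
  have : ∀ (d : n.divisors) (K : {K : Subgroup G // K.index = d}), Finite (G ⧸ K.1) :=
    fun d K => Subgroup.index_ne_zero_iff_finite.1 (K.2.trans_ne (hd d))
  let := fun d : n.divisors => Fintype.ofFinite {K : Subgroup G // K.index = d}
  rw [subgroupCount, ← Nat.card_congr (Equiv.ofBijective _
      ⟨cyclicExtensionMap_injective n, cyclicExtensionMap_surjective hn⟩),
    Nat.card_sigma, ← Finset.sum_coe_sort n.divisors]
  refine Finset.sum_congr rfl fun d _ => ?_
  rw [Nat.card_sigma, Finset.sum_congr rfl (fun K _ => (show Nat.card (G ⧸ K.1) = d from K.2)),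
    Finset.sum_const, Finset.card_univ, ← Nat.card_eq_fintype_card, smul_eq_mul, mul_comm,
    subgroupCount]

end

lemma subgroupCount_congr {G H : Type*} [Group G] [Group H] (e : G ≃* H) (n : ℕ) :
    subgroupCount G n = subgroupCount H n :=
  Nat.card_congr (e.mapSubgroup.toEquiv.subtypeEquiv fun K => by
    change _ ↔ (K.map (e : G →* H)).index = n
    rw [Subgroup.index_map_equiv])

lemma subgroupCount_of_subsingleton (G : Type*) [Group G] [Subsingleton G] (n : ℕ) :
    subgroupCount G n = if n = 1 then 1 else 0 := by
  have h : ∀ H : Subgroup G, H.index = 1 := fun H =>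
    Subgroup.index_eq_one.2 (Subsingleton.elim _ _)
  split_ifs with hn
  · subst hn
    rw [subgroupCount, Nat.card_congr (Equiv.subtypeUnivEquiv h), Nat.card_unique]
  · rw [subgroupCount, Nat.card_eq_zero]
    exact Or.inl ⟨fun H => hn (H.2.symm.trans (h H.1))⟩

/-- The isomorphism `ℤ ^ (m + 1) ≃ ℤ ^ m × ℤ` which splits off the last coordinate. -/
def intPowSuccEquiv (m : ℕ) : IntPow (m + 1) ≃* IntPow m × Multiplicative ℤ where
  toFun v := (fun i => v i.castSucc, v (Fin.last m))
  invFun p := Fin.snoc p.1 p.2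
  left_inv v := Fin.snoc_init_self v
  right_inv p := by simp
  map_mul' _ _ := rfl

lemma subgroupCount_intPow_succ (m : ℕ) {n : ℕ} (hn : n ≠ 0) :
    subgroupCount (IntPow (m + 1)) n = ∑ d ∈ n.divisors, d * subgroupCount (IntPow m) d := by
  rw [subgroupCount_congr (intPowSuccEquiv m), subgroupCount_prod hn]

/-! ### Factorizations -/

/-- The ordered factorizations of `n` into `k` factors; there are none for `n = 0`. -/
def factorizations (k n : ℕ) : Finset (Fin k → ℕ+) :=
  (Nat.finMulAntidiag k n).preimage (fun i j => (i j : ℕ))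
    (Function.Injective.injOn fun _ _ h => funext fun j => PNat.eq (congrFun h j))

lemma mem_factorizations {k n : ℕ} (i : Fin k → ℕ+) :
    i ∈ factorizations k n ↔ ∏ j, (i j : ℕ) = n := by
  rw [factorizations, Finset.mem_preimage, Nat.mem_finMulAntidiag, and_iff_left_iff_imp]
  rintro rfl
  exact Finset.prod_ne_zero_iff.2 fun j _ => (i j).ne_zero

lemma factorizations_zero (n : ℕ) : factorizations 0 n = if n = 1 then Finset.univ else ∅ := by
  ext i
  rw [mem_factorizations, Fin.prod_univ_zero, eq_comm]
  split_ifs with hn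
  · exact iff_of_true hn (Finset.mem_univ i)
  · exact iff_of_false hn (Finset.notMem_empty i)

/-- The weight `i₁ ^ (k - 1) * i₂ ^ (k - 2) * ⋯ * i_k ^ 0` of a `k`-tuple. -/
def tupleWeight {k : ℕ} (i : Fin k → ℕ+) : ℕ :=
  ∏ j, (i j : ℕ) ^ (k - 1 - (j : ℕ))

lemma tupleWeight_succ {k : ℕ} (i : Fin (k + 1) → ℕ+) :
    tupleWeight i = (∏ j : Fin k, (i j.castSucc : ℕ)) * tupleWeight (fun j => i j.castSucc) := by
  rw [tupleWeight, Fin.prod_univ_castSucc, tupleWeight, ← Finset.prod_mul_distrib]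
  simp only [Fin.val_castSucc, Fin.val_last, Nat.add_sub_cancel, Nat.sub_self, pow_zero, mul_one]
  refine Finset.prod_congr rfl fun j _ => ?_
  rw [← pow_succ']
  congr 1
  lia

lemma snoc_mem_factorizations {k n d : ℕ} (hd : d ∈ n.divisors) {i : Fin k → ℕ+}
    (hi : i ∈ factorizations k d) :
    (Fin.snoc i (n / d).toPNat' : Fin (k + 1) → ℕ+) ∈ factorizations (k + 1) n := by
  rw [mem_factorizations] at hi
  rw [mem_factorizations, Fin.prod_univ_castSucc]
  simp only [Fin.snoc_castSucc, Fin.snoc_last, Nat.toPNat'_coe]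
  rw [hi, if_pos (Nat.pos_of_ne_zero (div_ne_zero_of_mem_divisors hd)),
    Nat.mul_div_cancel' (Nat.dvd_of_mem_divisors hd)]

lemma last_eq_div_of_mem_factorizations {k n : ℕ} {i : Fin (k + 1) → ℕ+}
    (hi : i ∈ factorizations (k + 1) n) :
    (n / ∏ j : Fin k, (i j.castSucc : ℕ)).toPNat' = i (Fin.last k) := by
  rw [mem_factorizations, Fin.prod_univ_castSucc] at hi
  rw [Nat.div_eq_of_eq_mul_right (Finset.prod_pos fun j _ => PNat.pos _) hi.symm, PNat.coe_toPNat']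

lemma sum_factorizations_succ {A : Type*} [AddCommMonoid A] (k : ℕ) {n : ℕ} (hn : n ≠ 0)
    (f : (Fin k → ℕ+) → A) :
    ∑ i ∈ factorizations (k + 1) n, f (fun j => i j.castSucc) =
      ∑ d ∈ n.divisors, ∑ i ∈ factorizations k d, f i := by
  rw [Finset.sum_sigma']
  refine (Finset.sum_bij' (fun x _ => Fin.snoc (α := fun _ => ℕ+) x.2 (n / x.1).toPNat')
    (fun i _ => ⟨∏ j : Fin k, (i j.castSucc : ℕ), fun j => i j.castSucc⟩) ?_ ?_ ?_ ?_ ?_).symm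
  · rintro ⟨d, i⟩ hx
    exact snoc_mem_factorizations (Finset.mem_sigma.1 hx).1 (Finset.mem_sigma.1 hx).2
  · intro i hi
    rw [mem_factorizations, Fin.prod_univ_castSucc] at hi
    exact Finset.mem_sigma.2
      ⟨Nat.mem_divisors.2 ⟨⟨_, hi.symm⟩, hn⟩, (mem_factorizations _).2 rfl⟩
  · rintro ⟨d, i⟩ hx
    have hi := (mem_factorizations i).1 (Finset.mem_sigma.1 hx).2
    simp only [Fin.snoc_castSucc] at hi ⊢
    rw [hi]
  · intro i hi
    rw [last_eq_div_of_mem_factorizations hi]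
    exact Fin.snoc_init_self i
  · rintro ⟨d, i⟩ -
    simp only [Fin.snoc_castSucc]

lemma subgroupCount_intPow (k : ℕ) {n : ℕ} (hn : n ≠ 0) :
    subgroupCount (IntPow k) n = ∑ i ∈ factorizations k n, tupleWeight i := by
  induction k generalizing n with
  | zero =>
    rw [subgroupCount_of_subsingleton, factorizations_zero]
    split_ifs <;> simp [tupleWeight]
  | succ k ih =>
    simp only [subgroupCount_intPow_succ k hn, tupleWeight_succ]
    rw [sum_factorizations_succ k hn fun i => (∏ j, (i j : ℕ)) * tupleWeight i]
    refine Finset.sum_congr rfl fun d hd => ?_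
    rw [ih (Nat.pos_of_mem_divisors hd).ne', Finset.mul_sum]
    exact Finset.sum_congr rfl fun i hi => by rw [(mem_factorizations i).1 hi]

/-! ### The exponential recursion for actions on finite sets -/

section

variable {G α β : Type*} [Group G]

/-- The bijection between the actions on `α` and those on `β` induced by an equivalence. -/
def renameHom (e : α ≃ β) : (G →* Equiv.Perm α) ≃ (G →* Equiv.Perm β) :=
  e.permCongrHom.monoidHomCongrRightEquiv

lemma renameHom_apply (e : α ≃ β) (φ : G →* Equiv.Perm α) (g : G) (a : α) :
    renameHom e φ g (e a) = e (φ g a) := by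
  change e (φ g (e.symm (e a))) = _
  rw [Equiv.symm_apply_apply]

lemma numOrbits_renameHom (e : α ≃ β) (φ : G →* Equiv.Perm α) :
    numOrbits (renameHom e φ) = numOrbits φ := by
  refine (Nat.card_congr (Quotient.congr e fun a b => ?_)).symm
  refine (orbitSetoid_iff _ _ _).trans (Iff.trans ?_ (orbitSetoid_iff _ _ _).symm)
  refine exists_congr fun g => ?_
  rw [renameHom_apply, e.injective.eq_iff]

lemma orbitSum_congr [Group.FG G] [Finite α] [Finite β] (e : α ≃ β) (x : ℚ) :
    orbitSum G α x = orbitSum G β x :=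
  Fintype.sum_equiv (renameHom e) _ _ fun φ => by rw [numOrbits_renameHom]

variable (p : α → Prop) [DecidablePred p]

/-- The disjoint union of two actions. -/
def unionHom (ψ : (G →* Equiv.Perm {a // p a}) × (G →* Equiv.Perm {a // ¬ p a})) :
    G →* Equiv.Perm α :=
  (Equiv.Perm.subtypeCongrHom p).comp (ψ.1.prod ψ.2)

variable {p}

lemma unionHom_apply_left (ψ : (G →* Equiv.Perm {a // p a}) × (G →* Equiv.Perm {a // ¬ p a}))
    (g : G) (a : {a // p a}) : unionHom p ψ g a = ψ.1 g a :=
  Equiv.Perm.subtypeCongr.left_apply_subtype _ _ a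

lemma unionHom_apply_right (ψ : (G →* Equiv.Perm {a // p a}) × (G →* Equiv.Perm {a // ¬ p a}))
    (g : G) (a : {a // ¬ p a}) : unionHom p ψ g a = ψ.2 g a :=
  Equiv.Perm.subtypeCongr.right_apply_subtype _ _ a

lemma unionHom_apply_iff (ψ : (G →* Equiv.Perm {a // p a}) × (G →* Equiv.Perm {a // ¬ p a}))
    (g : G) (a : α) : p (unionHom p ψ g a) ↔ p a := by
  by_cases h : p a
  · rw [unionHom_apply_left ψ g ⟨a, h⟩]
    exact iff_of_true (Subtype.prop _) h
  · rw [unionHom_apply_right ψ g ⟨a, h⟩]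
    exact iff_of_false (ψ.2 g ⟨a, h⟩).2 h

lemma unionHom_injective : Function.Injective (unionHom (G := G) p) := by
  intro ψ ψ' h
  refine Prod.ext ?_ ?_
  · ext g a
    rw [← unionHom_apply_left, ← unionHom_apply_left, h]
  · ext g a
    rw [← unionHom_apply_right, ← unionHom_apply_right, h]

/-- The restriction of an action to an invariant set of points. -/
def restrictHom {q : α → Prop} (φ : G →* Equiv.Perm α) (hφ : ∀ g a, q (φ g a) ↔ q a) :
    G →* Equiv.Perm {a // q a} where
  toFun g := (φ g).subtypePerm (hφ g)
  map_one' := Equiv.ext fun a => Subtype.ext (Equiv.congr_fun (map_one φ) a)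
  map_mul' g h := Equiv.ext fun a => Subtype.ext (Equiv.congr_fun (map_mul φ g h) a)

lemma unionHom_restrictHom (φ : G →* Equiv.Perm α) (hφ : ∀ g a, p (φ g a) ↔ p a) :
    unionHom p (restrictHom φ hφ, restrictHom φ fun g a => not_congr (hφ g a)) = φ := by
  ext g a
  by_cases h : p a
  · exact unionHom_apply_left _ g ⟨a, h⟩
  · exact unionHom_apply_right _ g ⟨a, h⟩

lemma orbitSetoid_unionHom_right_iff
    (ψ : (G →* Equiv.Perm {a // p a}) × (G →* Equiv.Perm {a // ¬ p a})) (b b' : {a // ¬ p a}) :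
    orbitSetoid (unionHom p ψ) b b' ↔ orbitSetoid ψ.2 b b' := by
  simp only [orbitSetoid_iff, unionHom_apply_right, Subtype.ext_iff]

lemma not_orbitSetoid_unionHom
    (ψ : (G →* Equiv.Perm {a // p a}) × (G →* Equiv.Perm {a // ¬ p a})) (a : {a // p a})
    (b : {a // ¬ p a}) : ¬ orbitSetoid (unionHom p ψ) a b := by
  rw [orbitSetoid_iff]
  rintro ⟨g, hg⟩
  exact b.2 (hg ▸ (unionHom_apply_iff ψ g a).2 a.2)

lemma numOrbits_unionHom [Finite α]
    (ψ : (G →* Equiv.Perm {a // p a}) × (G →* Equiv.Perm {a // ¬ p a})) (a₀ : {a // p a})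
    (h : ∀ a b, ∃ g, ψ.1 g a = b) : numOrbits (unionHom p ψ) = numOrbits ψ.2 + 1 := by
  let f : Option (Quotient (orbitSetoid ψ.2)) → Quotient (orbitSetoid (unionHom p ψ)) := fun o =>
    o.elim (Quotient.mk _ a₀.1) (Quotient.map Subtype.val fun b b' =>
      (orbitSetoid_unionHom_right_iff ψ b b').2)
  have hf : Function.Bijective f := by
    constructor
    · rintro (_ | ⟨⟨b⟩⟩) (_ | ⟨⟨b'⟩⟩) hb
      · rfl
      · exact absurd (Quotient.exact hb) (not_orbitSetoid_unionHom ψ a₀ b')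
      · exact absurd (Quotient.exact hb.symm) (not_orbitSetoid_unionHom ψ a₀ b)
      · exact congrArg some
          (Quotient.sound ((orbitSetoid_unionHom_right_iff ψ b b').1 (Quotient.exact hb)))
    · rintro ⟨a⟩
      by_cases ha : p a
      · obtain ⟨g, hg⟩ := h a₀ ⟨a, ha⟩
        refine ⟨none, Quotient.sound ((orbitSetoid_iff _ _ _).2 ⟨g, ?_⟩)⟩
        rw [unionHom_apply_left, hg]
      · exact ⟨some (Quotient.mk _ ⟨a, ha⟩), rfl⟩
  rw [numOrbits, numOrbits, ← Nat.card_congr (Equiv.ofBijective f hf), Finite.card_option]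

/-- The union of a transitive action on `p` and any action on the complement, as an action for
which `p` is the orbit of `a₀`. -/
def orbitUnionHom (a₀ : {a // p a})
    (ψ : TransitiveHom G {a // p a} × (G →* Equiv.Perm {a // ¬ p a})) :
    {φ : G →* Equiv.Perm α // ∀ a, p a ↔ ∃ g, φ g a₀ = a} :=
  ⟨unionHom p (ψ.1.1, ψ.2), fun a => ⟨fun ha => by
    obtain ⟨g, hg⟩ := ψ.1.2 a₀ ⟨a, ha⟩
    exact ⟨g, by rw [unionHom_apply_left, hg]⟩, by
    rintro ⟨g, rfl⟩
    exact (unionHom_apply_iff _ g _).2 a₀.2⟩⟩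

lemma orbitUnionHom_injective (a₀ : {a // p a}) :
    Function.Injective (orbitUnionHom (G := G) a₀) := by
  rintro ⟨⟨ψ₁, h₁⟩, ψ₂⟩ ⟨⟨ψ₁', h₁'⟩, ψ₂'⟩ h
  obtain ⟨rfl, rfl⟩ := Prod.mk.inj (unionHom_injective (congrArg Subtype.val h))
  rfl

lemma apply_mem_orbit_iff {q : α → Prop} {φ : G →* Equiv.Perm α} {a₀ : α}
    (hφ : ∀ a, q a ↔ ∃ g, φ g a₀ = a) (g : G) (a : α) : q (φ g a) ↔ q a := by
  simp only [hφ, ← orbitSetoid_iff]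
  have ha : orbitSetoid φ a (φ g a) := (orbitSetoid_iff _ _ _).2 ⟨g, rfl⟩
  exact ⟨fun h => Setoid.trans' _ h (Setoid.symm' _ ha), fun h => Setoid.trans' _ h ha⟩

lemma orbitUnionHom_surjective (a₀ : {a // p a}) :
    Function.Surjective (orbitUnionHom (G := G) a₀) := by
  rintro ⟨φ, hφ⟩
  have hinv := apply_mem_orbit_iff hφ
  refine ⟨(⟨restrictHom φ hinv, transitive_of_forall_exists_apply_eq (a₀ := a₀) fun a => ?_⟩,
    restrictHom φ fun g a => not_congr (hinv g a)), Subtype.ext (unionHom_restrictHom φ hinv)⟩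
  obtain ⟨g, hg⟩ := (hφ a).1 a.2
  exact ⟨g, Subtype.ext hg⟩

lemma orbitUnionHom_bijective (a₀ : {a // p a}) :
    Function.Bijective (orbitUnionHom (G := G) a₀) :=
  ⟨orbitUnionHom_injective a₀, orbitUnionHom_surjective a₀⟩

omit [DecidablePred p] in
lemma sum_pow_numOrbits_of_orbit_eq [Group.FG G] [Finite α] (a₀ : {a // p a}) (x : ℚ)
    [Fintype {φ : G →* Equiv.Perm α // ∀ a, p a ↔ ∃ g, φ g a₀ = a}] :
    ∑ φ : {φ : G →* Equiv.Perm α // ∀ a, p a ↔ ∃ g, φ g a₀ = a}, x ^ numOrbits φ.1 =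
      x * Nat.card (TransitiveHom G {a // p a}) * orbitSum G {a // ¬ p a} x := by
  classical
  let := Fintype.ofFinite (TransitiveHom G {a // p a})
  rw [← (orbitUnionHom_bijective a₀).sum_comp fun φ => x ^ numOrbits φ.1, Fintype.sum_prod_type]
  have horbits : ∀ (ψ : TransitiveHom G {a // p a}) (ψ' : G →* Equiv.Perm {a // ¬ p a}),
      x ^ numOrbits (orbitUnionHom a₀ (ψ, ψ')).1 = x ^ numOrbits ψ' * x := fun ψ ψ' => by
    rw [orbitUnionHom, numOrbits_unionHom _ a₀ ψ.2, pow_succ]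
  simp only [horbits]
  rw [Finset.sum_const, ← Finset.sum_mul, Finset.card_univ, Nat.card_eq_fintype_card, nsmul_eq_mul,
    orbitSum]
  ring

end

section

variable (G : Type*) [Group G] [Group.FG G] {α : Type*} [Fintype α]

open Classical in
/-- The orbit of `a₀` as a finite set. -/
def orbitFinset {G : Type*} [Group G] (a₀ : α) (φ : G →* Equiv.Perm α) : Finset α :=
  Finset.univ.filter fun a => ∃ g, φ g a₀ = a

lemma self_mem_orbitFinset {G : Type*} [Group G] (a₀ : α) (φ : G →* Equiv.Perm α) :
    a₀ ∈ orbitFinset a₀ φ := by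
  classical
  exact (Finset.mem_filter_univ _).2 ⟨1, by rw [map_one, Equiv.Perm.one_apply]⟩

lemma sum_pow_numOrbits_orbitFinset_eq [DecidableEq α] {a₀ : α} {S : Finset α} (hS : a₀ ∈ S)
    (x : ℚ) :
    ∑ φ : G →* Equiv.Perm α with orbitFinset a₀ φ = S, x ^ numOrbits φ =
      x * ((S.card - 1).factorial * subgroupCount G S.card) *
        orbitSum G (Fin (Fintype.card α - S.card)) x := by
  have : Nonempty {a // a ∈ S} := ⟨⟨a₀, hS⟩⟩
  have e : {a // ¬ a ∈ S} ≃ Fin (Fintype.card α - S.card) := Fintype.equivFinOfCardEq (by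
    rw [Fintype.card_subtype_compl, Fintype.card_coe])
  let := Fintype.ofFinite
    {φ : G →* Equiv.Perm α // ∀ a, a ∈ S ↔ ∃ g, φ g a₀ = a}
  have h := sum_pow_numOrbits_of_orbit_eq (G := G) (p := fun a => a ∈ S) ⟨a₀, hS⟩ x
  rw [card_transitiveHom, orbitSum_congr e, Nat.card_eq_fintype_card, Fintype.card_coe,
    Nat.cast_mul] at h
  rw [← h]
  refine Finset.sum_subtype _ (fun φ => ?_) _
  rw [Finset.mem_filter_univ, orbitFinset, Finset.ext_iff]
  simp only [Finset.mem_filter_univ, iff_comm]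

lemma orbitSum_eq_sum_orbitFinset [DecidableEq α] (a₀ : α) (x : ℚ) :
    orbitSum G α x = ∑ S ∈ (Finset.univ.erase a₀).powerset,
      ∑ φ : G →* Equiv.Perm α with orbitFinset a₀ φ = insert a₀ S, x ^ numOrbits φ := by
  have huniv : (Finset.univ : Finset (Finset α)) =
      (insert a₀ (Finset.univ.erase a₀)).powerset := by
    rw [Finset.insert_erase (Finset.mem_univ _), Finset.powerset_univ]
  rw [orbitSum, ← Finset.sum_fiberwise (g := orbitFinset a₀), huniv,
    Finset.sum_powerset_insert (Finset.notMem_erase _ _), Finset.sum_eq_zero, zero_add]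
  refine fun S hS => Finset.sum_eq_zero fun φ hφ => ?_
  obtain rfl := (Finset.mem_filter.1 hφ).2
  exact absurd (Finset.mem_powerset.1 hS (self_mem_orbitFinset a₀ φ)) (Finset.notMem_erase _ _)

-- The summand for `k` counts the actions for which the orbit of `0` has `k + 1` points.
lemma orbitSum_succ (n : ℕ) (x : ℚ) :
    orbitSum G (Fin (n + 1)) x = ∑ k ∈ Finset.range (n + 1),
      n.choose k * (x * (k.factorial * subgroupCount G (k + 1)) * orbitSum G (Fin (n - k)) x) := by
  have hcard : (Finset.univ.erase (0 : Fin (n + 1))).card = n := by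
    rw [Finset.card_erase_of_mem (Finset.mem_univ _), Finset.card_fin, Nat.add_sub_cancel]
  have hpowerset := Finset.sum_powerset_apply_card (fun k =>
    x * (k.factorial * subgroupCount G (k + 1)) * orbitSum G (Fin (n - k)) x)
    (x := Finset.univ.erase (0 : Fin (n + 1)))
  simp only [hcard, nsmul_eq_mul] at hpowerset
  rw [orbitSum_eq_sum_orbitFinset G 0, ← hpowerset]
  refine Finset.sum_congr rfl fun S hS => ?_
  have h0 : (0 : Fin (n + 1)) ∉ S := fun h =>
    Finset.notMem_erase _ _ (Finset.mem_powerset.1 hS h)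
  rw [sum_pow_numOrbits_orbitFinset_eq G (Finset.mem_insert_self _ _),
    Finset.card_insert_of_notMem h0, Fintype.card_fin, Nat.add_sub_cancel, Nat.add_sub_add_right]

end

/-! ### Logarithmic derivatives of power series -/

section

open PowerSeries

lemma derivation_prod_of_eq {R A ι : Type*} [CommSemiring R] [CommSemiring A] [Algebra R A]
    (D : Derivation R A A) {f a : ι → A} (h : ∀ i, D (f i) = a i * f i) (s : Finset ι) :
    D (∏ i ∈ s, f i) = (∑ i ∈ s, a i) * ∏ i ∈ s, f i := by
  induction s using Finset.cons_induction with
  | empty => rw [Finset.prod_empty, Finset.sum_empty, D.map_one_eq_zero, zero_mul]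
  | cons i s hi ih =>
    rw [Finset.prod_cons, Finset.sum_cons, D.leibniz, ih, h, smul_eq_mul, smul_eq_mul]
    ring

lemma derivation_pow_of_eq {R A : Type*} [CommSemiring R] [CommSemiring A] [Algebra R A]
    (D : Derivation R A A) {f a : A} (h : D f = a * f) (k : ℕ) :
    D (f ^ k) = k * a * f ^ k := by
  have hprod := derivation_prod_of_eq D (fun _ => h) (Finset.range k)
  rwa [Finset.prod_const, Finset.sum_const, Finset.card_range, nsmul_eq_mul] at hprod

lemma derivative_inv_of_eq {K : Type*} [Field K] {f a : K⟦X⟧} (h : d⁄dX K f = a * f)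
    (hf : constantCoeff f ≠ 0) : d⁄dX K f⁻¹ = -a * f⁻¹ := by
  rw [derivative_inv', h]
  linear_combination (-a * f⁻¹) * PowerSeries.inv_mul_cancel f hf

lemma coeff_eq_of_derivative_eq {R : Type*} [CommRing R] [IsAddTorsionFree R] {f h a b : R⟦X⟧}
    (hf : d⁄dX R f = a * f) (hh : d⁄dX R h = b * h) (h0 : constantCoeff f = constantCoeff h)
    {d : ℕ} (hab : ∀ j < d, coeff j a = coeff j b) : ∀ n ≤ d, coeff n f = coeff n h := by
  intro n
  induction n using Nat.strong_induction_on with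
  | _ n ih =>
    intro hn
    rcases n with _ | n
    · rwa [coeff_zero_eq_constantCoeff_apply, coeff_zero_eq_constantCoeff_apply]
    · have hderiv : coeff n (d⁄dX R f) = coeff n (d⁄dX R h) := by
        rw [hf, hh, coeff_mul, coeff_mul]
        refine Finset.sum_congr rfl fun p hp => ?_
        have := Finset.HasAntidiagonal.mem_antidiagonal.1 hp
        rw [hab _ (by lia), ih _ (by lia) (by lia)]
      rw [coeff_derivative, coeff_derivative, ← Nat.cast_succ, mul_comm, ← nsmul_eq_mul, mul_comm,
        ← nsmul_eq_mul] at hderiv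
      exact nsmul_right_injective n.succ_ne_zero hderiv

lemma constantCoeff_seriesZPow {f : ℚ⟦X⟧} (hf : constantCoeff f = 1) (k : ℤ) :
    constantCoeff (seriesZPow f k) = 1 := by
  cases k with
  | ofNat k => rw [seriesZPow, map_pow, hf, one_pow]
  | negSucc k => rw [seriesZPow, map_pow, constantCoeff_inv, hf, inv_one, one_pow]

lemma derivative_seriesZPow {f a : ℚ⟦X⟧} (h : d⁄dX ℚ f = a * f) (hf : constantCoeff f ≠ 0) (k : ℤ) :
    d⁄dX ℚ (seriesZPow f k) = k * a * seriesZPow f k := by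
  cases k with
  | ofNat k => rw [seriesZPow, derivation_pow_of_eq _ h, Int.ofNat_eq_natCast, Int.cast_natCast]
  | negSucc k =>
    rw [seriesZPow, derivation_pow_of_eq _ (derivative_inv_of_eq h hf), Int.cast_negSucc, mul_neg,
      neg_mul (Nat.cast (k + 1))]

/-- The series `u ^ (N - 1) / (1 - u ^ N)`, which up to the factor `-N` is the logarithmic
derivative of `1 - u ^ N`. -/
def dvdSeries (N : ℕ) : ℚ⟦X⟧ :=
  mk fun k => if N ∣ k + 1 then 1 else 0

lemma dvdSeries_mul {N : ℕ} (hN : N ≠ 0) : dvdSeries N * (1 - X ^ N) = X ^ (N - 1) := by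
  ext k
  rw [mul_sub, mul_one, map_sub, coeff_mul_X_pow', coeff_X_pow, dvdSeries, coeff_mk]
  by_cases hk : N ≤ k
  · have hdvd : N ∣ k + 1 ↔ N ∣ k - N + 1 := by
      rw [← Nat.sub_add_comm hk, Nat.dvd_sub_self_right, or_iff_left (by lia)]
    rw [if_pos hk, coeff_mk, if_congr hdvd rfl rfl, sub_self, if_neg (by lia)]
  · rw [if_neg hk, sub_zero]
    refine if_congr ⟨fun h => ?_, ?_⟩ rfl rfl
    · have := Nat.le_of_dvd k.succ_pos h
      lia
    · rintro rfl
      rw [Nat.sub_add_cancel (Nat.pos_of_ne_zero hN)]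

lemma derivative_one_sub_X_pow {N : ℕ} (hN : N ≠ 0) :
    d⁄dX ℚ (1 - (X : ℚ⟦X⟧) ^ N) = (-(N : ℚ⟦X⟧) * dvdSeries N) * (1 - X ^ N) := by
  rw [mul_assoc, dvdSeries_mul hN, map_sub, Derivation.map_one_eq_zero, Derivation.leibniz_pow,
    derivative_X, smul_eq_mul, mul_one, nsmul_eq_mul, zero_sub, neg_mul]

lemma constantCoeff_one_sub_X_pow {N : ℕ} (hN : N ≠ 0) :
    constantCoeff (1 - (X : ℚ⟦X⟧) ^ N) = 1 := by
  rw [map_sub, map_pow, constantCoeff_X, zero_pow hN, map_one, sub_zero]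

end

/-! ### The generating function of the actions on finite sets -/

section

open PowerSeries

variable (G : Type*) [Group G] [Group.FG G]

/-- The exponential generating function of the numbers `orbitSum G (Fin n) x`. -/
def orbitSeries (x : ℚ) : ℚ⟦X⟧ :=
  mk fun n => orbitSum G (Fin n) x / n.factorial

lemma orbitSum_of_isEmpty (α : Type*) [Finite α] [IsEmpty α] (x : ℚ) : orbitSum G α x = 1 := by
  have hφ : ∀ φ : G →* Equiv.Perm α, x ^ numOrbits φ = 1 := fun φ => by
    rw [numOrbits, Nat.card_of_isEmpty, pow_zero]
  have : Unique (G →* Equiv.Perm α) := ⟨⟨1⟩, fun _ => MonoidHom.ext fun _ => Subsingleton.elim _ _⟩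
  rw [orbitSum, Fintype.sum_unique, hφ]

lemma constantCoeff_orbitSeries (x : ℚ) : constantCoeff (orbitSeries G x) = 1 := by
  rw [← coeff_zero_eq_constantCoeff_apply, orbitSeries, coeff_mk, orbitSum_of_isEmpty,
    Nat.factorial_zero, Nat.cast_one, div_one]

/-- The generating function of the numbers of subgroups of finite index: the coefficient of `u ^ k`
counts the subgroups of index `k + 1`. -/
def subgroupSeries : ℚ⟦X⟧ :=
  mk fun k => (subgroupCount G (k + 1) : ℚ)

lemma derivative_orbitSeries (x : ℚ) :
    d⁄dX ℚ (orbitSeries G x) = (C x * subgroupSeries G) * orbitSeries G x := by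
  ext n
  rw [coeff_derivative, coeff_mul, Finset.Nat.sum_antidiagonal_eq_sum_range_succ_mk, orbitSeries,
    coeff_mk, orbitSum_succ, Nat.factorial_succ, Nat.cast_mul, Nat.cast_succ, div_mul_eq_mul_div,
    mul_comm, mul_div_mul_left _ _ n.cast_add_one_ne_zero, Finset.sum_div]
  refine Finset.sum_congr rfl fun k hk => ?_
  rw [coeff_C_mul, subgroupSeries, coeff_mk, coeff_mk,
    Nat.cast_choose ℚ (Nat.lt_succ_iff.1 (Finset.mem_range.1 hk))]
  field_simp

lemma orbitSeries_intCast (k : ℤ) : orbitSeries G k = seriesZPow (orbitSeries G 1) k := by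
  have hone := constantCoeff_orbitSeries G 1
  ext n
  refine coeff_eq_of_derivative_eq (derivative_orbitSeries G k)
    (derivative_seriesZPow (derivative_orbitSeries G 1) (hone.trans_ne one_ne_zero) k) ?_
    (fun j _ => ?_) n le_rfl
  · rw [constantCoeff_orbitSeries, constantCoeff_seriesZPow hone]
  · rw [map_one, one_mul, map_intCast]

end

/-! ### The product formula -/

lemma sum_dvd_eq_subgroupCount {k n : ℕ} {s : Finset (Fin k → ℕ+)}
    (hs : ∀ e ∈ n.divisors, factorizations k e ⊆ s) (hn : n ≠ 0) :
    ∑ i ∈ s with (∏ j, (i j : ℕ)) ∣ n, (∏ j, (i j : ℕ)) * tupleWeight i =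
      subgroupCount (IntPow (k + 1)) n := by
  rw [subgroupCount_intPow_succ k hn, ← Finset.sum_fiberwise_of_maps_to (t := n.divisors)
    (g := fun i : Fin k → ℕ+ => ∏ j, (i j : ℕ))
    (fun i hi => Nat.mem_divisors.2 ⟨(Finset.mem_filter.1 hi).2, hn⟩)]
  refine Finset.sum_congr rfl fun e he => ?_
  rw [subgroupCount_intPow k (Nat.pos_of_mem_divisors he).ne', Finset.mul_sum]
  refine Finset.sum_congr ?_ fun i hi => by rw [(mem_factorizations i).1 hi]
  ext i
  rw [Finset.mem_filter, Finset.mem_filter, mem_factorizations, and_iff_right_iff_imp]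
  rintro rfl
  exact ⟨hs _ he ((mem_factorizations i).2 rfl), Nat.dvd_of_mem_divisors he⟩

open PowerSeries in
lemma coeff_sum_tupleWeight_mul_dvdSeries {k d : ℕ} {s : Finset (Fin k → ℕ+)}
    (hs : ∀ e ≤ d + 1, factorizations k e ⊆ s) (c : ℤ) :
    coeff d (∑ i ∈ s, ((-(c * tupleWeight i) : ℤ) : ℚ⟦X⟧) *
        (-((∏ j, (i j : ℕ) : ℕ) : ℚ⟦X⟧) * dvdSeries (∏ j, (i j : ℕ)))) =
      coeff d (C (c : ℚ) * subgroupSeries (IntPow (k + 1))) := by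
  have hs' : ∀ e ∈ (d + 1).divisors, factorizations k e ⊆ s := fun e he =>
    hs e (Nat.divisor_le he)
  rw [coeff_C_mul, subgroupSeries, coeff_mk, ← sum_dvd_eq_subgroupCount hs' d.succ_ne_zero,
    map_sum, Finset.sum_filter, Nat.cast_sum, Finset.mul_sum]
  refine Finset.sum_congr rfl fun i _ => ?_
  have hscalar : ((-(c * tupleWeight i) : ℤ) : ℚ⟦X⟧) *
      (-((∏ j, (i j : ℕ) : ℕ) : ℚ⟦X⟧) * dvdSeries (∏ j, (i j : ℕ))) =
      C (c * ((∏ j, (i j : ℕ) : ℕ) * tupleWeight i : ℕ) : ℚ) * dvdSeries (∏ j, (i j : ℕ)) := by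
    rw [map_mul, map_intCast, map_natCast]
    push_cast
    ring
  rw [hscalar, coeff_C_mul, dvdSeries, coeff_mk, mul_ite, mul_one, mul_zero, Nat.cast_ite,
    Nat.cast_zero, mul_ite, mul_zero]

open PowerSeries in
lemma hasFormalProd_orbitSeries (k : ℕ) (c : ℤ) :
    HasFormalProd (fun i : Fin k → ℕ+ =>
        seriesZPow (1 - (PowerSeries.X : ℚ⟦X⟧) ^ (∏ j, (i j : ℕ))) (-(c * tupleWeight i)))
      (orbitSeries (IntPow (k + 1)) c) := by
  classical
  intro d
  filter_upwards [Filter.eventually_ge_atTop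
    ((Finset.range (d + 1)).biUnion fun n => factorizations k n)] with s hs
  have hfactorizations : ∀ e ≤ d, factorizations k e ⊆ s := fun e he =>
    (Finset.subset_biUnion_of_mem _ (Finset.mem_range.2 (Nat.lt_succ_of_le he))).trans hs
  have hne : ∀ i : Fin k → ℕ+, ∏ j, (i j : ℕ) ≠ 0 := fun i =>
    Finset.prod_ne_zero_iff.2 fun j _ => (i j).ne_zero
  have hconst := fun i => constantCoeff_one_sub_X_pow (hne i)
  have hprod := derivation_prod_of_eq _ (fun i => derivative_seriesZPow
    (derivative_one_sub_X_pow (hne i)) ((hconst i).trans_ne one_ne_zero) (-(c * tupleWeight i))) s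
  refine coeff_eq_of_derivative_eq hprod (derivative_orbitSeries _ _) ?_ (fun n hn => ?_) d le_rfl
  · rw [constantCoeff_orbitSeries, map_prod]
    exact Finset.prod_eq_one fun i _ => constantCoeff_seriesZPow (hconst i) _
  · exact coeff_sum_tupleWeight_mul_dvdSeries (fun e he => hfactorizations e (he.trans hn)) c

lemma mk_sum_commutingTuples (m : ℕ) (x : ℚ) :
    (PowerSeries.mk fun n => (1 / (n.factorial : ℚ)) *
      ∑ π ∈ commutingTuples (Equiv.Perm (Fin n)) m, x ^ numComponents π) =
    orbitSeries (IntPow m) x := by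
  simp only [orbitSeries, sum_commutingTuples, one_div_mul_eq_div]

lemma mk_card_commutingTuples (m : ℕ) :
    (PowerSeries.mk fun n =>
      ((commutingTuples (Equiv.Perm (Fin n)) m).card : ℚ) / (n.factorial : ℚ)) =
    orbitSeries (IntPow m) 1 := by
  simp only [← mk_sum_commutingTuples, one_pow, Finset.sum_const, nsmul_eq_mul, mul_one,
    one_div_mul_eq_div]

theorem theorem1_general (M : Type u) [TopologicalSpace M]
    (hM : HasFiniteRationalHomology M) (m : ℕ) (hm : 1 ≤ m) :
    (∀ n : ℕ, ∀ π ∈ commutingTuples (Equiv.Perm (Fin n)) m,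
      HasFiniteRationalHomology (simultaneousFixedPoints (Fin n → M) π)) ∧
    orbifoldGeneratingFunction M m =
      PowerSeries.mk (fun n : ℕ => (1 / (n.factorial : ℚ)) *
        ∑ π ∈ commutingTuples (Equiv.Perm (Fin n)) m,
          (eulerCharacteristic M : ℚ) ^ numComponents π) ∧
    orbifoldGeneratingFunction M m =
      seriesZPow
        (PowerSeries.mk fun n : ℕ =>
          ((commutingTuples (Equiv.Perm (Fin n)) m).card : ℚ) / (n.factorial : ℚ))
        (eulerCharacteristic M) ∧
    HasFormalProd
      (fun i : Fin (m - 1) → ℕ+ =>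
        seriesZPow (1 - (PowerSeries.X : ℚ⟦X⟧) ^ (∏ j, (i j : ℕ)))
          (-(eulerCharacteristic M * ∏ j, ((i j : ℕ) : ℤ) ^ (m - 2 - (j : ℕ)))))
      (orbifoldGeneratingFunction M m) := by
  have hgen := orbifoldGeneratingFunction_eq hM m
  refine ⟨fun n π _ => ?_, hgen, ?_, ?_⟩
  · obtain ⟨p, hp⟩ := (hasFiniteRationalHomology_iff M).1 hM
    exact (hasFiniteRationalHomology_iff _).2 ⟨_, hp.fixedPoints π⟩
  · rw [hgen, mk_sum_commutingTuples, mk_card_commutingTuples, orbitSeries_intCast]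
  · obtain ⟨k, rfl⟩ := Nat.exists_eq_add_of_le' hm
    rw [hgen, mk_sum_commutingTuples]
    have hprod := hasFormalProd_orbitSeries k (eulerCharacteristic M)
    simp only [tupleWeight, Nat.cast_prod, Nat.cast_pow] at hprod
    exact hprod

theorem theorem1
    {E : Type*} [NormedAddCommGroup E] [NormedSpace ℝ E] [FiniteDimensional ℝ E]
    {H : Type*} [TopologicalSpace H] (_I : ModelWithCorners ℝ E H)
    (M : Type u) [TopologicalSpace M] [T2Space M] [SecondCountableTopology M] [ChartedSpace H M]
    (hM : HasFiniteRationalHomology M) (m : ℕ) (hm : 1 ≤ m) :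
    -- all the Euler characteristics in the definition of `χ_m(M^n, S_n)` are defined
    (∀ n : ℕ, ∀ π ∈ commutingTuples (Equiv.Perm (Fin n)) m,
      HasFiniteRationalHomology (simultaneousFixedPoints (Fin n → M) π)) ∧
    orbifoldGeneratingFunction M m =
      PowerSeries.mk (fun n : ℕ => (1 / (n.factorial : ℚ)) *
        ∑ π ∈ commutingTuples (Equiv.Perm (Fin n)) m,
          (eulerCharacteristic M : ℚ) ^ numComponents π) ∧
    orbifoldGeneratingFunction M m =
      seriesZPow
        (PowerSeries.mk fun n : ℕ =>
          ((commutingTuples (Equiv.Perm (Fin n)) m).card : ℚ) / (n.factorial : ℚ))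
        (eulerCharacteristic M) ∧
    -- the index `j : Fin (m - 1)` stands for `j + 1`, so `m - 2 - j` is the exponent of `i_{j+1}`
    HasFormalProd
      (fun i : Fin (m - 1) → ℕ+ =>
        seriesZPow (1 - (PowerSeries.X : ℚ⟦X⟧) ^ (∏ j, (i j : ℕ)))
          (-(eulerCharacteristic M * ∏ j, ((i j : ℕ) : ℤ) ^ (m - 2 - (j : ℕ)))))
      (orbifoldGeneratingFunction M m) :=
  theorem1_general M hM m hm

end
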